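/- Let $\mathbb{K}$ be a field of characteristic zero and let $D = \mathbb{K}\langle x_1,\dots,x_n,\partial_1,\dots,\partial_n\rangle$ be the $n$-th Weyl algebra, with relations $\partial_i x_i = x_i\partial_i + 1$, $\partial_i x_j = x_j \partial_i$ for $i \neq j$, $x_i x_j = x_j x_i$ and $\partial_i\partial_j = \partial_j\partial_i$. Let $0 \neq w \in \mathbb{R}_{\ge 0}^n$ be a weight vector whose entries lie in $\mathbb{K}$ (precisely: they lie in a subfield $L \subseteq \mathbb{R}$ of which $\mathbb{K}$ is an extension field). For $0\neq p = \sum_{\alpha,\beta} c_{\alpha\beta}x^\alpha\partial^\beta \in D$ let $m = \max\{-w\cdot\alpha + w\cdot\beta \mid c_{\alpha\beta}\neq 0\}$ and $\mathrm{in}_{(-w,w)}(p) = \sum_{-w\cdot\alpha+w\cdot\beta=m} c_{\alpha\beta}x^\alpha\partial^\beta$; put $\mathrm{in}_{(-w,w)}(0)=0$. For a left ideal $I \subseteq D$ let $\mathrm{in}_{(-w,w)}(I)$ be the $\mathbb{K}$-span of $\{\mathrm{in}_{(-w,w)}(p) \mid p\in I\}$. Put $s = \sum_{i=1}^n w_i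 x_i\partial_i \in D$. The global $b$-function of $I$ with respect to $w$ is the polynomial $b$ in one variable over $\mathbb{K}$, zero or monic, such that $b(s)$ generates $\mathrm{in}_{(-w,w)}(I)\cap\mathbb{K}[s]$ as an ideal of $\mathbb{K}[s]$. Let $I \subseteq D$ be a left ideal such that the left $D$-module $M = D/I$ is holonomic, that is, $\operatorname{GK.dim}(D/\operatorname{Ann} M) = 2\cdot \operatorname{GK.dim}(M)$, where $\operatorname{GK.dim}$ denotes the Gel'fand-Kirillov dimension over $\mathbb{K}$ (with $\operatorname{GK.dim}(0)=0$). Then $$\mathrm{in}_{(-w,w)}(I)\cap\mathbb{K}[s]\neq 0,$$ and the global $b$-function of $I$ with respect to $w$ exists, is unique, and is nonzero. -/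

import Mathlib

/-! ## The Weyl algebra -/

/-- The defining relations of the `n`-th Weyl algebra; the generator `Sum.inl i` stands for `x_i`
and `Sum.inr i` for `∂_i`. -/
inductive WeylRel (K : Type*) [Field K] (n : ℕ) :
    FreeAlgebra K (Fin n ⊕ Fin n) → FreeAlgebra K (Fin n ⊕ Fin n) → Prop
  | x_comm (i j : Fin n) : WeylRel K n
      (FreeAlgebra.ι K (Sum.inl i) * FreeAlgebra.ι K (Sum.inl j))
      (FreeAlgebra.ι K (Sum.inl j) * FreeAlgebra.ι K (Sum.inl i))
  | d_comm (i j : Fin n) : WeylRel K n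
      (FreeAlgebra.ι K (Sum.inr i) * FreeAlgebra.ι K (Sum.inr j))
      (FreeAlgebra.ι K (Sum.inr j) * FreeAlgebra.ι K (Sum.inr i))
  | d_x_self (i : Fin n) : WeylRel K n
      (FreeAlgebra.ι K (Sum.inr i) * FreeAlgebra.ι K (Sum.inl i))
      (FreeAlgebra.ι K (Sum.inl i) * FreeAlgebra.ι K (Sum.inr i) + 1)
  | d_x_ne (i j : Fin n) (h : i ≠ j) : WeylRel K n
      (FreeAlgebra.ι K (Sum.inr i) * FreeAlgebra.ι K (Sum.inl j))
      (FreeAlgebra.ι K (Sum.inl j) * FreeAlgebra.ι K (Sum.inr i))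

/-- The `n`-th Weyl algebra `D_n` over `K`, by generators and relations. -/
def WeylAlgebra (K : Type*) [Field K] (n : ℕ) : Type _ := RingQuot (WeylRel K n)

namespace WeylAlgebra

noncomputable section

instance instRing (K : Type*) [Field K] (n : ℕ) : Ring (WeylAlgebra K n) :=
  inferInstanceAs (Ring (RingQuot (WeylRel K n)))

instance instAlgebra (K : Type*) [Field K] (n : ℕ) : Algebra K (WeylAlgebra K n) :=
  inferInstanceAs (Algebra K (RingQuot (WeylRel K n)))

/-- The quotient map from the free algebra. -/
def mk (K : Type*) [Field K] (n : ℕ) : FreeAlgebra K (Fin n ⊕ Fin n) →ₐ[K] WeylAlgebra K n :=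
  RingQuot.mkAlgHom K (WeylRel K n)

theorem mk_rel {K : Type*} [Field K] {n : ℕ} {a b : FreeAlgebra K (Fin n ⊕ Fin n)}
    (h : WeylRel K n a b) : mk K n a = mk K n b :=
  RingQuot.mkAlgHom_rel K h

theorem mk_surjective (K : Type*) [Field K] (n : ℕ) : Function.Surjective (mk K n) :=
  RingQuot.mkAlgHom_surjective K (WeylRel K n)

/-- The generator `x_i`. -/
def x (K : Type*) [Field K] {n : ℕ} (i : Fin n) : WeylAlgebra K n :=
  mk K n (FreeAlgebra.ι K (Sum.inl i))

/-- The generator `∂_i`. -/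
def d (K : Type*) [Field K] {n : ℕ} (i : Fin n) : WeylAlgebra K n :=
  mk K n (FreeAlgebra.ι K (Sum.inr i))

theorem x_comm (K : Type*) [Field K] {n : ℕ} (i j : Fin n) : x K i * x K j = x K j * x K i := by
  have h := mk_rel (WeylRel.x_comm (K := K) i j)
  rw [map_mul, map_mul] at h
  exact h

theorem d_comm (K : Type*) [Field K] {n : ℕ} (i j : Fin n) : d K i * d K j = d K j * d K i := by
  have h := mk_rel (WeylRel.d_comm (K := K) i j)
  rw [map_mul, map_mul] at h
  exact h

theorem d_x_self (K : Type*) [Field K] {n : ℕ} (i : Fin n) :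
    d K i * x K i = x K i * d K i + 1 := by
  have h := mk_rel (WeylRel.d_x_self (K := K) i)
  rw [map_add, map_mul, map_mul, map_one] at h
  exact h

theorem d_x_ne (K : Type*) [Field K] {n : ℕ} {i j : Fin n} (hij : i ≠ j) :
    d K i * x K j = x K j * d K i := by
  have h := mk_rel (WeylRel.d_x_ne (K := K) i j hij)
  rw [map_mul, map_mul] at h
  exact h

theorem x_pow_pairwise (K : Type*) [Field K] {n : ℕ} (α : Fin n → ℕ) :
    ((Finset.univ : Finset (Fin n)) : Set (Fin n)).Pairwise
      (Function.onFun Commute fun i => x K i ^ α i) :=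
  fun i _ j _ _ => Commute.pow_pow (x_comm K i j) (α i) (α j)

theorem d_pow_pairwise (K : Type*) [Field K] {n : ℕ} (β : Fin n → ℕ) :
    ((Finset.univ : Finset (Fin n)) : Set (Fin n)).Pairwise
      (Function.onFun Commute fun i => d K i ^ β i) :=
  fun i _ j _ _ => Commute.pow_pow (d_comm K i j) (β i) (β j)

/-- The monomial `x^α = x_1^{α_1} ⋯ x_n^{α_n}`. -/
def xPow (K : Type*) [Field K] {n : ℕ} (α : Fin n →₀ ℕ) : WeylAlgebra K n :=
  Finset.univ.noncommProd (fun i => x K i ^ α i) (x_pow_pairwise K α)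

/-- The monomial `∂^β = ∂_1^{β_1} ⋯ ∂_n^{β_n}`. -/
def dPow (K : Type*) [Field K] {n : ℕ} (β : Fin n →₀ ℕ) : WeylAlgebra K n :=
  Finset.univ.noncommProd (fun i => d K i ^ β i) (d_pow_pairwise K β)

/-- The normally ordered monomial `x^α ∂^β`, indexed by the pair `(α, β)`. -/
def mono (K : Type*) [Field K] {n : ℕ} (e : (Fin n →₀ ℕ) × (Fin n →₀ ℕ)) : WeylAlgebra K n :=
  xPow K e.1 * dPow K e.2

theorem xPow_add (K : Type*) [Field K] {n : ℕ} (α α' : Fin n →₀ ℕ) :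
    xPow K (α + α') = xPow K α * xPow K α' := by
  unfold xPow
  rw [← Finset.noncommProd_mul_distrib]
  · exact Finset.noncommProd_congr rfl (fun i _ => by simp [pow_add]) _
  · exact fun i _ j _ _ => Commute.pow_pow (x_comm K i j) _ _

theorem dPow_add (K : Type*) [Field K] {n : ℕ} (β β' : Fin n →₀ ℕ) :
    dPow K (β + β') = dPow K β * dPow K β' := by
  unfold dPow
  rw [← Finset.noncommProd_mul_distrib]
  · exact Finset.noncommProd_congr rfl (fun i _ => by simp [pow_add]) _
  · exact fun i _ j _ _ => Commute.pow_pow (d_comm K i j) _ _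

theorem xPow_zero (K : Type*) [Field K] {n : ℕ} : xPow K (0 : Fin n →₀ ℕ) = 1 := by
  unfold xPow
  rw [Finset.noncommProd_eq_pow_card _ _ _ 1 (by simp), one_pow]

theorem dPow_zero (K : Type*) [Field K] {n : ℕ} : dPow K (0 : Fin n →₀ ℕ) = 1 := by
  unfold dPow
  rw [Finset.noncommProd_eq_pow_card _ _ _ 1 (by simp), one_pow]

theorem xPow_single (K : Type*) [Field K] {n : ℕ} (i : Fin n) :
    xPow K (Finsupp.single i 1) = x K i := by
  have h := (x_pow_pairwise K (n := n) (Finsupp.single i 1)).mono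
    (Finset.coe_subset.mpr (Finset.erase_subset i Finset.univ))
  have h1 := Finset.noncommProd_eq_pow_card (Finset.univ.erase i)
    (fun j => x K j ^ (Finsupp.single i 1 : Fin n →₀ ℕ) j) h 1 (fun j hj => by
      rw [Finsupp.single_eq_of_ne (Finset.ne_of_mem_erase hj), pow_zero])
  refine (Finset.mul_noncommProd_erase Finset.univ (Finset.mem_univ i) _ _ h).symm.trans ?_
  rw [h1]
  simp

theorem dPow_single (K : Type*) [Field K] {n : ℕ} (i : Fin n) :
    dPow K (Finsupp.single i 1) = d K i := by
  have h := (d_pow_pairwise K (n := n) (Finsupp.single i 1)).mono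
    (Finset.coe_subset.mpr (Finset.erase_subset i Finset.univ))
  have h1 := Finset.noncommProd_eq_pow_card (Finset.univ.erase i)
    (fun j => d K j ^ (Finsupp.single i 1 : Fin n →₀ ℕ) j) h 1 (fun j hj => by
      rw [Finsupp.single_eq_of_ne (Finset.ne_of_mem_erase hj), pow_zero])
  refine (Finset.mul_noncommProd_erase Finset.univ (Finset.mem_univ i) _ _ h).symm.trans ?_
  rw [h1]
  simp

/-- Induction on exponent vectors, raising one exponent by one in each step. -/
theorem exponent_induction {n : ℕ} {P : (Fin n →₀ ℕ) → Prop} (h0 : P 0)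
    (hs : ∀ i α, P α → P (Finsupp.single i 1 + α)) (α : Fin n →₀ ℕ) : P α := by
  induction α using Finsupp.induction with
  | zero => exact h0
  | single_add i m α _ _ ih =>
    clear * - ih hs
    induction m with
    | zero => simpa using ih
    | succ m ihm =>
      rw [add_comm m 1, Finsupp.single_add, add_assoc]
      exact hs i _ ihm

theorem d_mul_xPow (K : Type*) [Field K] {n : ℕ} (i : Fin n) (α : Fin n →₀ ℕ) :
    d K i * xPow K α = xPow K α * d K i + (α i : K) • xPow K (α - Finsupp.single i 1) := by
  induction α using exponent_induction with
  | h0 => simp [xPow_zero]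
  | hs j α ih =>
    rw [xPow_add, xPow_single, ← mul_assoc]
    by_cases hij : i = j
    · subst hij
      rw [d_x_self, add_mul, mul_assoc, ih, one_mul, mul_add, ← mul_assoc, add_assoc,
        add_tsub_cancel_left]
      congr 1
      rcases Nat.eq_zero_or_pos (α i) with h | h
      · simp [h]
      · have h2 : α = Finsupp.single i 1 + (α - Finsupp.single i 1) := by
          rw [add_tsub_cancel_of_le]
          simpa [Nat.one_le_iff_ne_zero, Nat.pos_iff_ne_zero] using h
        have h3 : x K i * xPow K (α - Finsupp.single i 1) = xPow K α := by
          conv_rhs => rw [h2, xPow_add, xPow_single]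
        rw [mul_smul_comm, h3]
        simp [add_smul, add_comm]
    · rw [d_x_ne K hij, mul_assoc, ih, mul_add, ← mul_assoc, mul_smul_comm]
      have h1 : (Finsupp.single j 1 + α : Fin n →₀ ℕ) i = α i := by
        simp [Finsupp.single_eq_of_ne hij]
      have h2 : (Finsupp.single j 1 + α - Finsupp.single i 1 : Fin n →₀ ℕ)
          = Finsupp.single j 1 + (α - Finsupp.single i 1) := by
        ext k
        by_cases hk : k = i
        · subst hk; simp [Finsupp.single_eq_of_ne hij]
        · simp [Finsupp.single_eq_of_ne hk]
      rw [h1, h2, xPow_add, xPow_single]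

theorem span_mono (K : Type*) [Field K] (n : ℕ) :
    Submodule.span K (Set.range (mono K (n := n))) = ⊤ := by
  set S := Submodule.span K (Set.range (mono K (n := n))) with hS
  have hmem : ∀ e, mono K (n := n) e ∈ S := fun e => Submodule.subset_span ⟨e, rfl⟩
  have hx : ∀ i, ∀ p ∈ S, x K i * p ∈ S := by
    intro i p hp
    induction hp using Submodule.span_induction with
    | mem p hp =>
      obtain ⟨e, rfl⟩ := hp
      have : x K i * mono K e = mono K (Finsupp.single i 1 + e.1, e.2) := by
        simp only [mono, xPow_add, xPow_single, mul_assoc]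
      rw [this]
      exact hmem _
    | zero => simp
    | add p q _ _ hp hq => rw [mul_add]; exact S.add_mem hp hq
    | smul c p _ hp => rw [mul_smul_comm]; exact S.smul_mem c hp
  have hd : ∀ i, ∀ p ∈ S, d K i * p ∈ S := by
    intro i p hp
    induction hp using Submodule.span_induction with
    | mem p hp =>
      obtain ⟨e, rfl⟩ := hp
      have : d K i * mono K e = mono K (e.1, Finsupp.single i 1 + e.2)
          + (e.1 i : K) • mono K (e.1 - Finsupp.single i 1, e.2) := by
        simp only [mono]
        rw [← mul_assoc, d_mul_xPow, add_mul, dPow_add, dPow_single, mul_assoc, smul_mul_assoc]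
      rw [this]
      exact S.add_mem (hmem _) (S.smul_mem _ (hmem _))
    | zero => simp
    | add p q _ _ hp hq => rw [mul_add]; exact S.add_mem hp hq
    | smul c p _ hp => rw [mul_smul_comm]; exact S.smul_mem c hp
  have hone : (1 : WeylAlgebra K n) ∈ S := by
    have := hmem (0, 0)
    simpa [mono, xPow_zero, dPow_zero] using this
  have key : ∀ a : FreeAlgebra K (Fin n ⊕ Fin n), ∀ p ∈ S, mk K n a * p ∈ S := by
    intro a
    induction a using FreeAlgebra.induction with
    | grade0 c =>
      intro p hp
      rw [AlgHom.commutes, ← Algebra.smul_def]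
      exact S.smul_mem c hp
    | grade1 g =>
      intro p hp
      cases g with
      | inl i => exact hx i p hp
      | inr i => exact hd i p hp
    | mul a b ha hb =>
      intro p hp
      rw [map_mul, mul_assoc]
      exact ha _ (hb _ hp)
    | add a b ha hb =>
      intro p hp
      rw [map_add, add_mul]
      exact S.add_mem (ha _ hp) (hb _ hp)
  rw [eq_top_iff]
  intro p _
  obtain ⟨a, rfl⟩ := mk_surjective K n p
  have := key a 1 hone
  rwa [mul_one] at this

/-- The action of the Weyl algebra on polynomials: `x_i` multiplies by the `i`-th variable and
`∂_i` is the `i`-th partial derivative. -/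
def polyAction (K : Type*) [Field K] (n : ℕ) :
    WeylAlgebra K n →ₐ[K] Module.End K (MvPolynomial (Fin n) K) :=
  RingQuot.liftAlgHom K ⟨FreeAlgebra.lift K (Sum.elim
      (fun i => LinearMap.mulLeft K (MvPolynomial.X i : MvPolynomial (Fin n) K))
      (fun i => ((MvPolynomial.pderiv i : Derivation K (MvPolynomial (Fin n) K)
        (MvPolynomial (Fin n) K)) : MvPolynomial (Fin n) K →ₗ[K] MvPolynomial (Fin n) K))), by
    intro a b h
    cases h with
    | x_comm i j =>
      refine LinearMap.ext fun f => ?_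
      simp [mul_left_comm]
    | d_comm i j =>
      refine MvPolynomial.linearMap_ext fun s => LinearMap.ext fun c => ?_
      simp only [map_mul, FreeAlgebra.lift_ι_apply, Sum.elim_inr, Module.End.mul_apply,
        LinearMap.comp_apply, Derivation.coeFn_coe, MvPolynomial.pderiv_monomial]
      rw [tsub_right_comm]
      congr 1
      by_cases hij : i = j
      · subst hij; rfl
      · simp [Finsupp.single_eq_of_ne hij, Finsupp.single_eq_of_ne (Ne.symm hij), mul_right_comm]
    | d_x_self i =>
      refine LinearMap.ext fun f => ?_
      simp [add_comm]
    | d_x_ne i j h =>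
      refine LinearMap.ext fun f => ?_
      simp [MvPolynomial.pderiv_X_of_ne h.symm]⟩

theorem polyAction_x (K : Type*) [Field K] {n : ℕ} (i : Fin n) (f : MvPolynomial (Fin n) K) :
    polyAction K n (x K i) f = MvPolynomial.X i * f := by
  have h : polyAction K n (x K i) = _ :=
    RingQuot.liftAlgHom_mkAlgHom_apply K _ _ (FreeAlgebra.ι K (Sum.inl i))
  rw [h]
  simp

theorem polyAction_d (K : Type*) [Field K] {n : ℕ} (i : Fin n) (f : MvPolynomial (Fin n) K) :
    polyAction K n (d K i) f = MvPolynomial.pderiv i f := by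
  have h : polyAction K n (d K i) = _ :=
    RingQuot.liftAlgHom_mkAlgHom_apply K _ _ (FreeAlgebra.ι K (Sum.inr i))
  rw [h]
  simp

theorem polyAction_xPow (K : Type*) [Field K] {n : ℕ} (α : Fin n →₀ ℕ)
    (f : MvPolynomial (Fin n) K) :
    polyAction K n (xPow K α) f = MvPolynomial.monomial α 1 * f := by
  induction α using exponent_induction with
  | h0 => simp [xPow_zero]
  | hs i α ih =>
    rw [xPow_add, xPow_single, map_mul, Module.End.mul_apply, ih, polyAction_x, ← mul_assoc,
      MvPolynomial.X, MvPolynomial.monomial_mul, one_mul]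

theorem polyAction_dPow (K : Type*) [Field K] {n : ℕ} (β γ : Fin n →₀ ℕ) :
    ∃ c : ℕ, (c ≠ 0 ↔ β ≤ γ) ∧
      polyAction K n (dPow K β) (MvPolynomial.monomial γ 1)
        = MvPolynomial.monomial (γ - β) (c : K) := by
  induction β using exponent_induction with
  | h0 => exact ⟨1, by simp, by simp [dPow_zero]⟩
  | hs i β ih =>
    obtain ⟨c, hc, h⟩ := ih
    refine ⟨c * (γ - β) i, ?_, ?_⟩
    · rw [mul_ne_zero_iff, hc, Finsupp.tsub_apply, Nat.sub_ne_zero_iff_lt]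
      constructor
      · rintro ⟨h1, h2⟩ k
        by_cases hk : k = i
        · subst hk; simpa [add_comm 1] using h2
        · simpa [Finsupp.single_eq_of_ne hk] using h1 k
      · intro h1
        refine ⟨le_trans le_add_self h1, ?_⟩
        have := h1 i
        simp only [Finsupp.add_apply, Finsupp.single_eq_same] at this
        omega
    · rw [dPow_add, dPow_single, map_mul, Module.End.mul_apply, h, polyAction_d,
        MvPolynomial.pderiv_monomial, tsub_tsub, add_comm β, Nat.cast_mul]

theorem linearIndependent_mono (K : Type*) [Field K] [CharZero K] (n : ℕ) :
    LinearIndependent K (mono K (n := n)) := by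
  rw [linearIndependent_iff]
  intro l hl
  by_contra hne
  have hsupp : l.support.Nonempty := Finsupp.support_nonempty_iff.mpr hne
  obtain ⟨e, he, hmin⟩ := l.support.exists_min_image (fun e => e.2.degree) hsupp
  obtain ⟨c, hc, hce⟩ := polyAction_dPow K e.2 e.2
  have hc0 : c ≠ 0 := hc.mpr le_rfl
  have h1 : polyAction K n (Finsupp.linearCombination K (mono K (n := n)) l)
      (MvPolynomial.monomial e.2 1) = 0 := by
    rw [hl, map_zero, LinearMap.zero_apply]
  have h2 := congrArg (MvPolynomial.coeff e.1) h1
  rw [Finsupp.linearCombination_apply, Finsupp.sum, map_sum, LinearMap.sum_apply,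
    MvPolynomial.coeff_sum, Finset.sum_eq_single e] at h2
  · rw [map_smul, LinearMap.smul_apply, mono, map_mul, Module.End.mul_apply, hce,
      polyAction_xPow, MvPolynomial.monomial_mul, tsub_self, add_zero, one_mul,
      MvPolynomial.coeff_smul, MvPolynomial.coeff_monomial, if_pos rfl, MvPolynomial.coeff_zero,
      smul_eq_mul, mul_eq_zero] at h2
    rcases h2 with h2 | h2
    · exact (Finsupp.mem_support_iff.mp he) h2
    · exact hc0 (by exact_mod_cast h2)
  · intro e' he' hne'
    obtain ⟨c', hc', hce'⟩ := polyAction_dPow K e'.2 e.2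
    rw [map_smul, LinearMap.smul_apply, mono, map_mul, Module.End.mul_apply, hce',
      polyAction_xPow, MvPolynomial.monomial_mul, one_mul, MvPolynomial.coeff_smul,
      MvPolynomial.coeff_monomial]
    by_cases hle : e'.2 ≤ e.2
    · have heq : e'.2 = e.2 := by
        by_contra hn
        have hlt : e'.2.degree < e.2.degree := by
          have h3 : e.2 = e'.2 + (e.2 - e'.2) := (add_tsub_cancel_of_le hle).symm
          have h4 : e.2 - e'.2 ≠ 0 := fun h => hn (le_antisymm hle (tsub_eq_zero_iff_le.mp h))
          rw [h3, map_add]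
          have h5 : (e.2 - e'.2).degree ≠ 0 := fun h => h4 ((Finsupp.degree_eq_zero_iff _).mp h)
          omega
        exact absurd (hmin e' he') (not_le.mpr hlt)
      rw [if_neg, smul_zero]
      rw [heq, tsub_self, add_zero]
      exact fun h => hne' (Prod.ext h heq)
    · have : c' = 0 := by
        by_contra h
        exact hle (hc'.mp h)
      simp [this]
  · exact fun h => absurd he h

/-- The normally ordered monomials `x^α ∂^β` form a `K`-basis of the Weyl algebra
(`K` a field of characteristic zero). -/
def basis (K : Type*) [Field K] [CharZero K] (n : ℕ) :
    Module.Basis ((Fin n →₀ ℕ) × (Fin n →₀ ℕ)) K (WeylAlgebra K n) :=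
  Module.Basis.mk (linearIndependent_mono K n) (span_mono K n).ge

/-! ## Initial forms and initial ideals -/

/-- The weight `-w·α + w·β` of the exponent pair `(α, β)`. -/
def wt {n : ℕ} (w : Fin n → ℝ) (e : (Fin n →₀ ℕ) × (Fin n →₀ ℕ)) : ℝ :=
  ∑ i, (-(w i * (e.1 i : ℝ)) + w i * (e.2 i : ℝ))

open Classical in
/-- The initial form `in_{(-w,w)}(p)`: the sum of those terms `c_{αβ} x^α ∂^β` of `p` with
`c_{αβ} ≠ 0` whose weight is the maximal one. It is `0` for `p = 0`. -/
def initialForm {K : Type*} [Field K] [CharZero K] {n : ℕ} (w : Fin n → ℝ)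
    (p : WeylAlgebra K n) : WeylAlgebra K n :=
  ∑ e ∈ ((basis K n).repr p).support with
      ∀ e' ∈ ((basis K n).repr p).support, wt w e' ≤ wt w e,
    (basis K n).repr p e • mono K e

/-- The initial ideal `in_{(-w,w)}(I) = K · {in_{(-w,w)}(p) | p ∈ I}`, as a `K`-subspace
of the Weyl algebra. -/
def initialIdeal {K : Type*} [Field K] [CharZero K] {n : ℕ} (w : Fin n → ℝ)
    (I : Ideal (WeylAlgebra K n)) : Submodule K (WeylAlgebra K n) :=
  Submodule.span K (initialForm w '' (I : Set (WeylAlgebra K n)))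

/-- The operator `s = ∑ c_i x_i ∂_i`. -/
def eulerOp {K : Type*} [Field K] {n : ℕ} (c : Fin n → K) : WeylAlgebra K n :=
  ∑ i, c i • (x K i * d K i)

end

end WeylAlgebra

/-! ## Gelfand-Kirillov dimension and holonomic modules -/

noncomputable section

/-- The growth `inf {r ≥ 0 | f(k) ≤ k^r for all large k}` of a function `f : ℕ → ℕ`. -/
def growthDegree (f : ℕ → ℕ) : ENNReal :=
  ⨅ (r : NNReal) (_ : ∀ᶠ k : ℕ in Filter.atTop, (f k : ℝ) ≤ (k : ℝ) ^ (r : ℝ)), (r : ENNReal)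

/-- The Gelfand-Kirillov dimension of a `K`-algebra `A`: the supremum of the growth of
`k ↦ dim_K V^k` over all finite-dimensional subspaces `V ⊆ A` with `1 ∈ V`. -/
def algGKDim (K A : Type*) [Field K] [Ring A] [Algebra K A] : ENNReal :=
  ⨆ (V : Submodule K A) (_ : FiniteDimensional K V) (_ : (1 : A) ∈ V),
    growthDegree fun k => Module.finrank K (V ^ k : Submodule K A)

/-- The Gelfand-Kirillov dimension of a left module `M` over a `K`-algebra `A`: the supremum of
the growth of `k ↦ dim_K (V^k F)` over all finite-dimensional subspaces `V ⊆ A` with `1 ∈ V` and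
`F ⊆ M`, where `V^k F` is the `K`-span of the products `a • m` with `a ∈ V^k` and `m ∈ F`. -/
def moduleGKDim (K A M : Type*) [Field K] [Ring A] [Algebra K A] [AddCommGroup M] [Module K M]
    [Module A M] [IsScalarTower K A M] : ENNReal :=
  ⨆ (V : Submodule K A) (_ : FiniteDimensional K V) (_ : (1 : A) ∈ V)
    (F : Submodule K M) (_ : FiniteDimensional K F),
    growthDegree fun k =>
      Module.finrank K (Submodule.span K (Set.image2 (fun (a : A) (m : M) => a • m)
        ((V ^ k : Submodule K A) : Set A) (F : Set M)))

/-- A left module `M` over a `K`-algebra `A` is holonomic if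
`GK.dim (A / Ann M) = 2 · GK.dim M`. -/
def IsHolonomic (K A M : Type*) [Field K] [Ring A] [Algebra K A] [AddCommGroup M] [Module K M]
    [Module A M] [IsScalarTower K A M] : Prop :=
  algGKDim K (A ⧸ Module.annihilator A M) = 2 * moduleGKDim K A M

end

/-! ## The global b-function -/

/-- `b` is the global b-function with respect to `J` and `s`: it is zero or monic, and `b(s)`
generates `J ∩ K[s]` as an ideal of `K[s]`. -/
def IsGlobalBFunction {K A : Type*} [Field K] [Ring A] [Algebra K A] (J : Submodule K A) (s : A)
    (b : Polynomial K) : Prop :=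
  (b = 0 ∨ b.Monic) ∧
    ((J ⊓ Subalgebra.toSubmodule (Algebra.adjoin K {s}) : Submodule K A) : Set A) =
      Set.range fun q : Polynomial K => Polynomial.aeval s q * Polynomial.aeval s b

namespace WeylAlgebra

/-! ### Commutation rules for normally ordered monomials -/

variable {K : Type*} [Field K] {n : ℕ}

/-! The argument is a dimension count in the style of Joseph. Write `J` for the initial ideal, `B_k`
for the Bernstein filtration, and `f_I(k)`, `f_J(k)` for the dimensions of the images of `B_k` in
`D/I` and `D/J`.

`J` is a left ideal, because the generators of `D` are homogeneous for the weight. It is also stable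
under right multiplication by `s`, because `[s, h]` is a scalar multiple of `h` for homogeneous `h`.

Suppose `J` contains no nonzero polynomial in `s`. Lift a basis of the image of `B_N` in `D/J` to
elements `P_i` of `B_N`, and send `(u_0, …, u_k)` in `B_N^(k+1)` to the classes of `∑ u_j P_i s^j`.
A kernel element satisfies `∑ u_j p s^j ∈ J` for every `p` in `B_N`. Commutators with `x_i` and
`∂_i` preserve this property while lowering the degree of the `u_j`, until a nonzero tuple of
constants puts a polynomial in `s` into `J` (`exists_aeval_mem_of_sum_mul_mem`). So the map is
injective, and `(k+1) · dim B_N ≤ f_J(N) · f_J(2N+2k)` (`mul_finrank_bernstein_le`).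

Comparing top-weight components gives `f_J ≤ f_I` (`finrank_map_mkQ_initialIdeal_le`). Every
quotient algebra of `D` has GK dimension at most `2n`, so holonomicity bounds the growth of `f_I` by
`n`. With `N` linear in `k`, the left side above is at least `k^(2n+1)` while the right side has
growth at most `2n`: a contradiction.

Existence and uniqueness of `b` then follow from `K[s]` being a polynomial ring, since `w ≠ 0` makes
`s` transcendental (`aeval_eulerOp_injective`). -/

theorem x_mul_mono (i : Fin n) (e : (Fin n →₀ ℕ) × (Fin n →₀ ℕ)) :
    x K i * mono K e = mono K (Finsupp.single i 1 + e.1, e.2) := by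
  simp only [mono, xPow_add, xPow_single, mul_assoc]

theorem d_mul_mono (i : Fin n) (e : (Fin n →₀ ℕ) × (Fin n →₀ ℕ)) :
    d K i * mono K e = mono K (e.1, Finsupp.single i 1 + e.2)
      + (e.1 i : K) • mono K (e.1 - Finsupp.single i 1, e.2) := by
  simp only [mono]
  rw [← mul_assoc, d_mul_xPow, add_mul, dPow_add, dPow_single, mul_assoc, smul_mul_assoc]

theorem x_mul_xPow (i : Fin n) (α : Fin n →₀ ℕ) : x K i * xPow K α = xPow K α * x K i := by
  rw [← xPow_single, ← xPow_add, ← xPow_add, add_comm]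

theorem d_mul_dPow (i : Fin n) (β : Fin n →₀ ℕ) : d K i * dPow K β = dPow K β * d K i := by
  rw [← dPow_single, ← dPow_add, ← dPow_add, add_comm]

theorem single_add_tsub_single {i : Fin n} {α : Fin n →₀ ℕ} (h : α i ≠ 0) :
    Finsupp.single i 1 + (α - Finsupp.single i 1) = α := by
  rw [add_tsub_cancel_of_le]
  simpa [Nat.one_le_iff_ne_zero] using h

theorem single_add_tsub_single_of_ne {i j : Fin n} (h : i ≠ j) (α : Fin n →₀ ℕ) :
    (Finsupp.single j 1 + α - Finsupp.single i 1 : Fin n →₀ ℕ)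
      = Finsupp.single j 1 + (α - Finsupp.single i 1) := by
  ext k
  by_cases hk : k = i
  · subst hk; simp [Finsupp.single_eq_of_ne h]
  · simp [Finsupp.single_eq_of_ne hk]

/-- The factor `α i` stays on both sides because truncated subtraction is wrong exactly when it
vanishes. -/
theorem smul_x_mul_xPow (i : Fin n) (α : Fin n →₀ ℕ) :
    (α i : K) • (x K i * xPow K (α - Finsupp.single i 1)) = (α i : K) • xPow K α := by
  by_cases h : α i = 0
  · simp [h]
  · rw [← xPow_single, ← xPow_add, single_add_tsub_single h]

theorem smul_d_mul_dPow (i : Fin n) (β : Fin n →₀ ℕ) :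
    (β i : K) • (d K i * dPow K (β - Finsupp.single i 1)) = (β i : K) • dPow K β := by
  by_cases h : β i = 0
  · simp [h]
  · rw [← dPow_single, ← dPow_add, single_add_tsub_single h]

theorem dPow_mul_x (i : Fin n) (β : Fin n →₀ ℕ) :
    dPow K β * x K i = x K i * dPow K β + (β i : K) • dPow K (β - Finsupp.single i 1) := by
  induction β using exponent_induction with
  | h0 => simp [dPow_zero]
  | hs j β ih =>
    rw [dPow_add, dPow_single, mul_assoc, ih, mul_add, ← mul_assoc, mul_smul_comm]
    by_cases hij : i = j
    · subst hij
      rw [smul_d_mul_dPow, d_x_self, add_mul, one_mul, mul_assoc, add_tsub_cancel_left]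
      simp [add_smul, add_assoc]
    · rw [d_x_ne K (Ne.symm hij), single_add_tsub_single_of_ne hij, dPow_add, dPow_single,
        mul_assoc]
      simp [Finsupp.single_eq_of_ne hij]

theorem mono_mul_x_sub (i : Fin n) (e : (Fin n →₀ ℕ) × (Fin n →₀ ℕ)) :
    mono K e * x K i - x K i * mono K e
      = (e.2 i : K) • mono K (e.1, e.2 - Finsupp.single i 1) := by
  simp only [mono]
  rw [mul_assoc, dPow_mul_x, mul_add, ← mul_assoc, ← x_mul_xPow, mul_assoc, add_sub_cancel_left,
    mul_smul_comm]

theorem d_mul_mono_sub (i : Fin n) (e : (Fin n →₀ ℕ) × (Fin n →₀ ℕ)) :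
    d K i * mono K e - mono K e * d K i
      = (e.1 i : K) • mono K (e.1 - Finsupp.single i 1, e.2) := by
  simp only [mono]
  rw [← mul_assoc, d_mul_xPow, add_mul, mul_assoc, d_mul_dPow, ← mul_assoc, add_sub_cancel_left,
    smul_mul_assoc]

/-- Commutation with `x_i ∂_i` is a derivation with `x_i ↦ x_i` and `∂_i ↦ -∂_i`, so it multiplies a
monomial by its exponent difference. -/
theorem theta_mul_mono_sub (i : Fin n) (e : (Fin n →₀ ℕ) × (Fin n →₀ ℕ)) :
    x K i * d K i * mono K e - mono K e * (x K i * d K i)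
      = ((e.1 i : K) - (e.2 i : K)) • mono K e := by
  have h1 : d K i * mono K e
      = mono K e * d K i + (e.1 i : K) • mono K (e.1 - Finsupp.single i 1, e.2) := by
    rw [← d_mul_mono_sub]; abel
  have h2 : mono K e * x K i
      = x K i * mono K e + (e.2 i : K) • mono K (e.1, e.2 - Finsupp.single i 1) := by
    rw [← mono_mul_x_sub]; abel
  have h3 : (e.1 i : K) • (x K i * mono K (e.1 - Finsupp.single i 1, e.2))
      = (e.1 i : K) • mono K e := by
    simp only [mono]
    rw [← mul_assoc, ← smul_mul_assoc, smul_x_mul_xPow, smul_mul_assoc]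
  have h4 : (e.2 i : K) • (mono K (e.1, e.2 - Finsupp.single i 1) * d K i)
      = (e.2 i : K) • mono K e := by
    simp only [mono]
    rw [mul_assoc, ← d_mul_dPow, ← mul_smul_comm, smul_d_mul_dPow, mul_smul_comm]
  rw [mul_assoc, h1, ← mul_assoc, h2, add_mul, mul_add, mul_smul_comm, smul_mul_assoc, h3, h4,
    sub_smul, mul_assoc]
  abel

theorem eulerOp_mul_mono_sub (c : Fin n → K) (e : (Fin n →₀ ℕ) × (Fin n →₀ ℕ)) :
    eulerOp c * mono K e - mono K e * eulerOp c
      = (∑ i, c i * ((e.1 i : K) - (e.2 i : K))) • mono K e := by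
  simp only [eulerOp, Finset.sum_mul, Finset.mul_sum, ← Finset.sum_sub_distrib, Finset.sum_smul]
  refine Finset.sum_congr rfl fun i _ => ?_
  rw [smul_mul_assoc, mul_smul_comm, ← smul_sub, theta_mul_mono_sub, smul_smul]

/-! ## The Bernstein filtration -/

/-- The exponent pairs of total degree at most `k`. -/
def degLE (n k : ℕ) : Set ((Fin n →₀ ℕ) × (Fin n →₀ ℕ)) :=
  {e | e.1.degree + e.2.degree ≤ k}

/-- The Bernstein filtration: operators of total degree at most `k` in the `x_i` and `∂_i`. -/
def bernstein (K : Type*) [Field K] (n k : ℕ) : Submodule K (WeylAlgebra K n) :=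
  Submodule.span K (mono K '' degLE n k)

theorem mono_mem_bernstein {k : ℕ} {e : (Fin n →₀ ℕ) × (Fin n →₀ ℕ)}
    (h : e.1.degree + e.2.degree ≤ k) : mono K e ∈ bernstein K n k :=
  Submodule.subset_span ⟨e, h, rfl⟩

theorem bernstein_mono {k l : ℕ} (h : k ≤ l) : bernstein K n k ≤ bernstein K n l :=
  Submodule.span_mono (Set.image_mono fun _ he => le_trans he h)

theorem one_eq_mono : (1 : WeylAlgebra K n) = mono K (0, 0) := by
  simp [mono, xPow_zero, dPow_zero]

theorem one_mem_bernstein (k : ℕ) : (1 : WeylAlgebra K n) ∈ bernstein K n k := by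
  rw [one_eq_mono]
  exact mono_mem_bernstein (by simp)

theorem x_mem_bernstein (i : Fin n) : x K i ∈ bernstein K n 1 := by
  have : x K i = mono K (Finsupp.single i 1, 0) := by simp [mono, xPow_single, dPow_zero]
  rw [this]
  exact mono_mem_bernstein (by simp)

theorem d_mem_bernstein (i : Fin n) : d K i ∈ bernstein K n 1 := by
  have : d K i = mono K (0, Finsupp.single i 1) := by simp [mono, xPow_zero, dPow_single]
  rw [this]
  exact mono_mem_bernstein (by simp)

theorem x_mul_mem_bernstein (i : Fin n) {k : ℕ} {p : WeylAlgebra K n}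
    (hp : p ∈ bernstein K n k) : x K i * p ∈ bernstein K n (k + 1) := by
  induction hp using Submodule.span_induction with
  | mem p hp =>
    obtain ⟨e, he, rfl⟩ := hp
    rw [x_mul_mono]
    refine mono_mem_bernstein ?_
    simp only [degLE, Set.mem_ofPred_eq] at he
    simp only [map_add, Finsupp.degree_single]
    omega
  | zero => simp
  | add p q _ _ hp hq => rw [mul_add]; exact add_mem hp hq
  | smul c p _ hp => rw [mul_smul_comm]; exact Submodule.smul_mem _ c hp

theorem degree_tsub_le (α β : Fin n →₀ ℕ) : (α - β).degree ≤ α.degree := by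
  have h : α - β ≤ α := tsub_le_self
  calc (α - β).degree ≤ (α - β).degree + (α - (α - β)).degree := Nat.le_add_right _ _
    _ = α.degree := by rw [← map_add, add_tsub_cancel_of_le h]

theorem degree_tsub_single {i : Fin n} {α : Fin n →₀ ℕ} (h : α i ≠ 0) :
    (α - Finsupp.single i 1).degree + 1 = α.degree := by
  conv_rhs => rw [← single_add_tsub_single h, map_add, Finsupp.degree_single]
  rw [add_comm]

theorem d_mul_mem_bernstein (i : Fin n) {k : ℕ} {p : WeylAlgebra K n}
    (hp : p ∈ bernstein K n k) : d K i * p ∈ bernstein K n (k + 1) := by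
  induction hp using Submodule.span_induction with
  | mem p hp =>
    obtain ⟨e, he, rfl⟩ := hp
    simp only [degLE, Set.mem_ofPred_eq] at he
    rw [d_mul_mono]
    refine add_mem (mono_mem_bernstein ?_) (Submodule.smul_mem _ _ (mono_mem_bernstein ?_))
    · simp only [map_add, Finsupp.degree_single]
      omega
    · have := degree_tsub_le e.1 (Finsupp.single i 1)
      simp only
      omega
  | zero => simp
  | add p q _ _ hp hq => rw [mul_add]; exact add_mem hp hq
  | smul c p _ hp => rw [mul_smul_comm]; exact Submodule.smul_mem _ c hp

theorem xPow_mul_mem_bernstein (α : Fin n →₀ ℕ) {k : ℕ} {p : WeylAlgebra K n}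
    (hp : p ∈ bernstein K n k) : xPow K α * p ∈ bernstein K n (α.degree + k) := by
  induction α using exponent_induction with
  | h0 => simpa [xPow_zero] using hp
  | hs i α ih =>
    rw [xPow_add, xPow_single, mul_assoc]
    refine bernstein_mono (le_of_eq ?_) (x_mul_mem_bernstein i ih)
    simp only [map_add, Finsupp.degree_single]
    omega

theorem dPow_mul_mem_bernstein (β : Fin n →₀ ℕ) {k : ℕ} {p : WeylAlgebra K n}
    (hp : p ∈ bernstein K n k) : dPow K β * p ∈ bernstein K n (β.degree + k) := by
  induction β using exponent_induction with
  | h0 => simpa [dPow_zero] using hp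
  | hs i β ih =>
    rw [dPow_add, dPow_single, mul_assoc]
    refine bernstein_mono (le_of_eq ?_) (d_mul_mem_bernstein i ih)
    simp only [map_add, Finsupp.degree_single]
    omega

theorem mul_mem_bernstein {k l : ℕ} {p q : WeylAlgebra K n}
    (hp : p ∈ bernstein K n k) (hq : q ∈ bernstein K n l) : p * q ∈ bernstein K n (k + l) := by
  induction hp using Submodule.span_induction with
  | mem p hp =>
    obtain ⟨e, he, rfl⟩ := hp
    simp only [degLE, Set.mem_ofPred_eq] at he
    rw [mono, mul_assoc]
    exact bernstein_mono (by omega) (xPow_mul_mem_bernstein e.1 (dPow_mul_mem_bernstein e.2 hq))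
  | zero => simp
  | add p q _ _ hp hq => rw [add_mul]; exact add_mem hp hq
  | smul c p _ hp => rw [smul_mul_assoc]; exact Submodule.smul_mem _ c hp

theorem bernstein_pow_le (l k : ℕ) : bernstein K n l ^ k ≤ bernstein K n (l * k) := by
  induction k with
  | zero =>
    rw [pow_zero, Submodule.one_le]
    exact one_mem_bernstein _
  | succ k ih =>
    rw [pow_succ, Submodule.mul_le]
    intro p hp q hq
    exact mul_mem_bernstein (ih hp) hq

/-- Together with `bernstein_pow_le` this gives `B_1^k = B_k`, which links the Bernstein filtration
to the powers `V^k` in the definition of GK dimension. -/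
theorem bernstein_le_pow (k : ℕ) : bernstein K n k ≤ bernstein K n 1 ^ k := by
  have h1 : (1 : Submodule K (WeylAlgebra K n)) ≤ bernstein K n 1 :=
    Submodule.one_le.mpr (one_mem_bernstein 1)
  have hx : ∀ α : Fin n →₀ ℕ, xPow K α ∈ bernstein K n 1 ^ α.degree := by
    intro α
    induction α using exponent_induction with
    | h0 =>
      rw [xPow_zero, map_zero, pow_zero]
      exact Submodule.one_le.mp le_rfl
    | hs i α ih =>
      rw [xPow_add, xPow_single, map_add, Finsupp.degree_single, pow_add, pow_one]
      exact Submodule.mul_mem_mul (x_mem_bernstein i) ih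
  have hd : ∀ β : Fin n →₀ ℕ, dPow K β ∈ bernstein K n 1 ^ β.degree := by
    intro β
    induction β using exponent_induction with
    | h0 =>
      rw [dPow_zero, map_zero, pow_zero]
      exact Submodule.one_le.mp le_rfl
    | hs i β ih =>
      rw [dPow_add, dPow_single, map_add, Finsupp.degree_single, pow_add, pow_one]
      exact Submodule.mul_mem_mul (d_mem_bernstein i) ih
  refine Submodule.span_le.mpr ?_
  rintro _ ⟨e, he, rfl⟩
  have h2 : mono K e ∈ bernstein K n 1 ^ (e.1.degree + e.2.degree) := by
    rw [pow_add]
    exact Submodule.mul_mem_mul (hx _) (hd _)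
  exact pow_le_pow_right₀ h1 he h2

theorem eulerOp_mem_bernstein (c : Fin n → K) : eulerOp c ∈ bernstein K n 2 := by
  unfold eulerOp
  exact Submodule.sum_mem _ fun i _ => Submodule.smul_mem _ _
    (mul_mem_bernstein (k := 1) (l := 1) (x_mem_bernstein i) (d_mem_bernstein i))

theorem exists_mem_bernstein (p : WeylAlgebra K n) : ∃ k, p ∈ bernstein K n k := by
  have hp : p ∈ Submodule.span K (Set.range (mono K (n := n))) := by
    rw [span_mono]; trivial
  induction hp using Submodule.span_induction with
  | mem p hp =>
    obtain ⟨e, rfl⟩ := hp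
    exact ⟨_, mono_mem_bernstein le_rfl⟩
  | zero => exact ⟨0, zero_mem _⟩
  | add p q _ _ hp hq =>
    obtain ⟨k, hk⟩ := hp
    obtain ⟨l, hl⟩ := hq
    exact ⟨max k l, add_mem (bernstein_mono (le_max_left _ _) hk)
      (bernstein_mono (le_max_right _ _) hl)⟩
  | smul c p _ hp =>
    obtain ⟨k, hk⟩ := hp
    exact ⟨k, Submodule.smul_mem _ _ hk⟩

/-- The exponent pairs all of whose entries are at most `k`. -/
noncomputable def box (n k : ℕ) : Finset ((Fin n →₀ ℕ) × (Fin n →₀ ℕ)) :=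
  Finset.Iic (Finsupp.equivFunOnFinite.symm fun _ => k) ×ˢ
    Finset.Iic (Finsupp.equivFunOnFinite.symm fun _ => k)

theorem card_Iic_const (n k : ℕ) :
    (Finset.Iic (Finsupp.equivFunOnFinite.symm fun _ : Fin n => k)).card = (k + 1) ^ n := by
  have h : (Finset.Iic (Finsupp.equivFunOnFinite.symm fun _ : Fin n => k)).card
      = (Finset.Iic (fun _ : Fin n => k)).card := by
    refine Finset.card_equiv Finsupp.equivFunOnFinite fun α => ?_
    simp only [Finset.mem_Iic, Finsupp.le_def, Pi.le_def]
    rfl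
  rw [h]
  simp [Pi.card_Iic]

theorem card_box (n k : ℕ) : (box n k).card = (k + 1) ^ (2 * n) := by
  rw [box, Finset.card_product, card_Iic_const, ← pow_add, two_mul]

/-- Simplices of exponents are squeezed between cubes, whose cardinality is a pure power. The loss
of a factor `2n` in the argument does not affect growth. -/
theorem degLE_subset_box (n k : ℕ) : degLE n k ⊆ box n k := by
  intro e he
  simp only [degLE, Set.mem_ofPred_eq] at he
  simp only [box, Finset.coe_product, Set.mem_prod, Finset.coe_Iic, Set.mem_Iic, Finsupp.le_def,
    Finsupp.equivFunOnFinite_symm_apply_apply]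
  have h : ∀ (α : Fin n →₀ ℕ) i, α i ≤ α.degree := fun α i => Finsupp.le_degree i α
  exact ⟨fun i => (h e.1 i).trans (by omega), fun i => (h e.2 i).trans (by omega)⟩

theorem box_subset_degLE (n k : ℕ) : (box n k : Set _) ⊆ degLE n (2 * n * k) := by
  intro e he
  simp only [box, Finset.coe_product, Set.mem_prod, Finset.coe_Iic, Set.mem_Iic, Finsupp.le_def,
    Finsupp.equivFunOnFinite_symm_apply_apply] at he
  have h : ∀ α : Fin n →₀ ℕ, (∀ i, α i ≤ k) → α.degree ≤ n * k := by
    intro α hα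
    rw [Finsupp.degree_eq_sum]
    exact (Finset.sum_le_card_nsmul _ _ k fun i _ => hα i).trans (by simp)
  have h1 := h e.1 he.1
  have h2 := h e.2 he.2
  simp only [degLE, Set.mem_ofPred_eq]
  calc _ ≤ n * k + n * k := add_le_add h1 h2
    _ = _ := by ring

theorem finite_degLE (n k : ℕ) : (degLE n k).Finite :=
  (box n k).finite_toSet.subset (degLE_subset_box n k)

instance finiteDimensional_bernstein (k : ℕ) : FiniteDimensional K (bernstein K n k) :=
  FiniteDimensional.span_of_finite K ((finite_degLE n k).image _)

theorem finrank_bernstein_le (k : ℕ) :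
    Module.finrank K (bernstein K n k) ≤ (k + 1) ^ (2 * n) := by
  classical
  have h : bernstein K n k ≤ Submodule.span K ((box n k).image (mono K) : Set _) := by
    refine Submodule.span_mono ?_
    rw [Finset.coe_image]
    exact Set.image_mono (degLE_subset_box n k)
  refine (Submodule.finrank_mono h).trans ((finrank_span_finset_le_card _).trans ?_)
  exact Finset.card_image_le.trans (card_box n k).le

theorem le_finrank_bernstein [CharZero K] (k : ℕ) :
    (k + 1) ^ (2 * n) ≤ Module.finrank K (bernstein K n (2 * n * k)) := by
  classical
  have h1 : LinearIndependent K (fun e : box n k => mono K (e : (Fin n →₀ ℕ) × (Fin n →₀ ℕ))) :=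
    (linearIndependent_mono K n).comp _ Subtype.val_injective
  have h2 := finrank_span_eq_card h1
  rw [Fintype.card_coe, card_box] at h2
  rw [← h2]
  refine Submodule.finrank_mono (Submodule.span_le.mpr ?_)
  rintro _ ⟨e, rfl⟩
  exact mono_mem_bernstein (box_subset_degLE n k e.2)

/-! ## Homogeneous components and the initial ideal -/

theorem wt_add_x (w : Fin n → ℝ) (i : Fin n) (e : (Fin n →₀ ℕ) × (Fin n →₀ ℕ)) :
    wt w (Finsupp.single i 1 + e.1, e.2) = wt w e - w i := by
  have h : ∀ j, w j * ((Finsupp.single i 1 : Fin n →₀ ℕ) j : ℝ) = if j = i then w i else 0 := by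
    intro j
    by_cases hj : j = i
    · subst hj; simp
    · simp [hj]
  simp only [wt, Finsupp.add_apply, Nat.cast_add, mul_add, neg_add, Finset.sum_add_distrib,
    Finset.sum_neg_distrib, h, Finset.sum_ite_eq', Finset.mem_univ, if_true]
  ring

theorem wt_add_d (w : Fin n → ℝ) (i : Fin n) (e : (Fin n →₀ ℕ) × (Fin n →₀ ℕ)) :
    wt w (e.1, Finsupp.single i 1 + e.2) = wt w e + w i := by
  have h : ∀ j, w j * ((Finsupp.single i 1 : Fin n →₀ ℕ) j : ℝ) = if j = i then w i else 0 := by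
    intro j
    by_cases hj : j = i
    · subst hj; simp
    · simp [hj]
  simp only [wt, Finsupp.add_apply, Nat.cast_add, mul_add, Finset.sum_add_distrib,
    h, Finset.sum_ite_eq', Finset.mem_univ, if_true]
  ring

theorem wt_tsub_x (w : Fin n → ℝ) {i : Fin n} {e : (Fin n →₀ ℕ) × (Fin n →₀ ℕ)}
    (h : e.1 i ≠ 0) : wt w (e.1 - Finsupp.single i 1, e.2) = wt w e + w i := by
  have := wt_add_x w i (e.1 - Finsupp.single i 1, e.2)
  simp only [single_add_tsub_single h] at this
  linarith

theorem mul_mem_of_generators {J : Submodule K (WeylAlgebra K n)}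
    (hx : ∀ i, ∀ p ∈ J, x K i * p ∈ J) (hd : ∀ i, ∀ p ∈ J, d K i * p ∈ J)
    (a : WeylAlgebra K n) {p : WeylAlgebra K n} (hp : p ∈ J) : a * p ∈ J := by
  obtain ⟨a, rfl⟩ := mk_surjective K n a
  induction a using FreeAlgebra.induction generalizing p with
  | grade0 c =>
    rw [AlgHom.commutes, ← Algebra.smul_def]
    exact J.smul_mem c hp
  | grade1 g =>
    cases g with
    | inl i => exact hx i p hp
    | inr i => exact hd i p hp
  | mul a b ha hb =>
    rw [map_mul, mul_assoc]
    exact ha (hb hp)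
  | add a b ha hb =>
    rw [map_add, add_mul]
    exact J.add_mem (ha hp) (hb hp)

theorem finrank_map_mkQ (J B : Submodule K (WeylAlgebra K n)) [FiniteDimensional K B] :
    Module.finrank K (B.map J.mkQ)
      + Module.finrank K (J ⊓ B : Submodule K (WeylAlgebra K n)) = Module.finrank K B := by
  have h1 := LinearMap.finrank_range_add_finrank_ker (J.mkQ.domRestrict B)
  rw [LinearMap.range_domRestrict, LinearMap.ker_domRestrict, Submodule.ker_mkQ] at h1
  rw [← h1, inf_comm, ← Submodule.map_comap_subtype]
  congr 1
  exact (LinearEquiv.finrank_eq (Submodule.equivMapOfInjective _ B.subtype_injective _)).symm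

variable [CharZero K]

open Classical in
/-- The homogeneous component of weight `m` with respect to the grading by `(-w, w)`. -/
noncomputable def homComp (K : Type*) [Field K] [CharZero K] {n : ℕ} (w : Fin n → ℝ) (m : ℝ) :
    WeylAlgebra K n →ₗ[K] WeylAlgebra K n where
  toFun p := (basis K n).repr.symm (((basis K n).repr p).filter fun e => wt w e = m)
  map_add' p q := by rw [map_add, Finsupp.filter_add, map_add]
  map_smul' c p := by rw [map_smul, Finsupp.filter_smul, map_smul, RingHom.id_apply]

theorem basis_apply (e : (Fin n →₀ ℕ) × (Fin n →₀ ℕ)) : basis K n e = mono K e :=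
  Module.Basis.mk_apply _ _ e

open Classical in
theorem homComp_mono (w : Fin n → ℝ) (m : ℝ) (e : (Fin n →₀ ℕ) × (Fin n →₀ ℕ)) :
    homComp K w m (mono K e) = if wt w e = m then mono K e else 0 := by
  change (basis K n).repr.symm (((basis K n).repr (mono K e)).filter fun e => wt w e = m) = _
  rw [← basis_apply, Module.Basis.repr_self]
  split_ifs with h
  · rw [Finsupp.filter_single_of_pos (p := fun e => wt w e = m) h]
    simp
  · rw [Finsupp.filter_single_of_neg (p := fun e => wt w e = m) h, map_zero]

open Classical in
theorem repr_homComp (w : Fin n → ℝ) (m : ℝ) (p : WeylAlgebra K n)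
    (e : (Fin n →₀ ℕ) × (Fin n →₀ ℕ)) :
    (basis K n).repr (homComp K w m p) e = if wt w e = m then (basis K n).repr p e else 0 := by
  change (basis K n).repr ((basis K n).repr.symm _) e = _
  rw [LinearEquiv.apply_symm_apply, Finsupp.filter_apply]

theorem homComp_homComp_self (w : Fin n → ℝ) (m : ℝ) (p : WeylAlgebra K n) :
    homComp K w m (homComp K w m p) = homComp K w m p := by
  refine (basis K n).repr.injective (Finsupp.ext fun e => ?_)
  simp only [repr_homComp]
  split_ifs <;> rfl

theorem homComp_homComp_of_ne (w : Fin n → ℝ) {m m' : ℝ} (h : m ≠ m') (p : WeylAlgebra K n) :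
    homComp K w m (homComp K w m' p) = 0 := by
  refine (basis K n).repr.injective (Finsupp.ext fun e => ?_)
  simp only [repr_homComp, map_zero, Finsupp.zero_apply]
  split_ifs with h1 h2
  · exact absurd (h1.symm.trans h2) h
  · rfl
  · rfl

theorem eq_zero_of_homComp_eq_zero (w : Fin n → ℝ) {p : WeylAlgebra K n}
    (h : ∀ m, homComp K w m p = 0) : p = 0 := by
  refine (basis K n).repr.injective (Finsupp.ext fun e => ?_)
  have := repr_homComp w (wt w e) p e
  rw [h, if_pos rfl] at this
  rw [← this]

theorem linearMap_ext_mono {M : Type*} [AddCommGroup M] [Module K M]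
    {f g : WeylAlgebra K n →ₗ[K] M} (h : ∀ e, f (mono K e) = g (mono K e)) : f = g :=
  (basis K n).ext fun e => by rw [basis_apply]; exact h e

theorem homComp_x_mul (w : Fin n → ℝ) (m : ℝ) (i : Fin n) (p : WeylAlgebra K n) :
    homComp K w m (x K i * p) = x K i * homComp K w (m + w i) p := by
  have : homComp K w m ∘ₗ LinearMap.mulLeft K (x K i)
      = LinearMap.mulLeft K (x K i) ∘ₗ homComp K w (m + w i) := by
    refine linearMap_ext_mono fun e => ?_
    simp only [LinearMap.comp_apply, LinearMap.mulLeft_apply, homComp_mono, x_mul_mono, wt_add_x,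
      sub_eq_iff_eq_add]
    split_ifs
    · rw [x_mul_mono]
    · rw [mul_zero]
  exact LinearMap.congr_fun this p

/-- Both terms of `∂_i x^α ∂^β` have the same weight: raising `β_i` and lowering `α_i` each add `w
i`. Hence `∂_i` is homogeneous. -/
theorem homComp_d_mul (w : Fin n → ℝ) (m : ℝ) (i : Fin n) (p : WeylAlgebra K n) :
    homComp K w m (d K i * p) = d K i * homComp K w (m - w i) p := by
  have : homComp K w m ∘ₗ LinearMap.mulLeft K (d K i)
      = LinearMap.mulLeft K (d K i) ∘ₗ homComp K w (m - w i) := by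
    refine linearMap_ext_mono fun e => ?_
    simp only [LinearMap.comp_apply, LinearMap.mulLeft_apply, homComp_mono, d_mul_mono, map_add,
      map_smul, wt_add_d, eq_sub_iff_add_eq]
    -- For `α_i = 0` the truncated exponent has the wrong weight, but its term has coefficient zero.
    by_cases h0 : e.1 i = 0
    · split_ifs <;> simp [h0, d_mul_mono]
    · rw [wt_tsub_x w h0]
      split_ifs
      · rw [d_mul_mono]
      · simp
  exact LinearMap.congr_fun this p

theorem homComp_mem_span (w : Fin n → ℝ) (m : ℝ) (S : Set ((Fin n →₀ ℕ) × (Fin n →₀ ℕ)))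
    {p : WeylAlgebra K n} (hp : p ∈ Submodule.span K (mono K '' S)) :
    homComp K w m p ∈ Submodule.span K (mono K '' S) := by
  induction hp using Submodule.span_induction with
  | mem p hp =>
    obtain ⟨e, he, rfl⟩ := hp
    rw [homComp_mono]
    split_ifs
    · exact Submodule.subset_span ⟨e, he, rfl⟩
    · exact zero_mem _
  | zero => simp
  | add p q _ _ hp hq => rw [map_add]; exact add_mem hp hq
  | smul c p _ hp => rw [map_smul]; exact Submodule.smul_mem _ c hp

theorem homComp_mem_bernstein (w : Fin n → ℝ) (m : ℝ) {k : ℕ}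
    {p : WeylAlgebra K n} (hp : p ∈ bernstein K n k) : homComp K w m p ∈ bernstein K n k :=
  homComp_mem_span w m _ hp

open Classical in
theorem initialForm_eq (w : Fin n → ℝ) (p : WeylAlgebra K n) :
    initialForm w p = (basis K n).repr.symm (((basis K n).repr p).filter fun e =>
      ∀ e' ∈ ((basis K n).repr p).support, wt w e' ≤ wt w e) := by
  rw [Finsupp.filter_eq_sum, map_sum, initialForm]
  refine Finset.sum_congr rfl fun e _ => ?_
  rw [Module.Basis.repr_symm_single, basis_apply]

theorem initialForm_eq_homComp (w : Fin n → ℝ) {p : WeylAlgebra K n} {m : ℝ}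
    (h : ∀ m', m < m' → homComp K w m' p = 0) (hm : homComp K w m p ≠ 0) :
    initialForm w p = homComp K w m p := by
  classical
  have hle : ∀ e ∈ ((basis K n).repr p).support, wt w e ≤ m := by
    intro e he
    by_contra hlt
    have := repr_homComp w (wt w e) p e
    rw [h _ (not_le.mp hlt), if_pos rfl, map_zero, Finsupp.zero_apply] at this
    exact Finsupp.mem_support_iff.mp he this.symm
  obtain ⟨e₀, he₀⟩ : ∃ e, (basis K n).repr (homComp K w m p) e ≠ 0 := by
    by_contra! hall
    exact hm ((basis K n).repr.injective (Finsupp.ext fun e => by rw [hall]; simp))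
  rw [repr_homComp] at he₀
  have hw₀ : wt w e₀ = m := by
    by_contra hne
    rw [if_neg hne] at he₀
    exact he₀ rfl
  rw [if_pos hw₀] at he₀
  rw [initialForm_eq]
  refine congrArg _ (Finsupp.ext fun e => ?_)
  rw [Finsupp.filter_apply, Finsupp.filter_apply]
  by_cases he : (basis K n).repr p e = 0
  · simp [he]
  · refine if_congr ⟨fun h1 => le_antisymm (hle e (Finsupp.mem_support_iff.mpr he)) ?_, ?_⟩ rfl rfl
    · rw [← hw₀]
      exact h1 e₀ (Finsupp.mem_support_iff.mpr he₀)
    · rintro rfl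
      exact hle

theorem exists_initialForm_eq_homComp (w : Fin n → ℝ) (p : WeylAlgebra K n) :
    ∃ m, (∀ m', m < m' → homComp K w m' p = 0) ∧ initialForm w p = homComp K w m p := by
  classical
  by_cases hp : p = 0
  · subst hp
    -- For `p = 0` any weight serves.
    exact ⟨0, fun _ _ => map_zero _, by simp [initialForm]⟩
  have hs : ((basis K n).repr p).support.Nonempty := by
    rw [Finsupp.support_nonempty_iff]
    simpa using hp
  obtain ⟨e, he, hmax⟩ := ((basis K n).repr p).support.exists_max_image (wt w) hs
  have h1 : ∀ m', wt w e < m' → homComp K w m' p = 0 := by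
    intro m' hm'
    refine (basis K n).repr.injective (Finsupp.ext fun e' => ?_)
    rw [repr_homComp, map_zero, Finsupp.zero_apply]
    split_ifs with h
    · by_contra hne
      have := hmax e' (Finsupp.mem_support_iff.mpr hne)
      linarith
    · rfl
  refine ⟨wt w e, h1, initialForm_eq_homComp w h1 fun h0 => ?_⟩
  have := repr_homComp w (wt w e) p e
  rw [h0, if_pos rfl, map_zero, Finsupp.zero_apply] at this
  exact Finsupp.mem_support_iff.mp he this.symm

/-! ### The initial ideal as a left ideal stable under right multiplication by the Euler operator -/

variable {w : Fin n → ℝ} {I : Ideal (WeylAlgebra K n)}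

/-- Here `m` only has to bound the weights of `p`, and the component may be zero. This spares any
proof that top components stay nonzero after multiplication. -/
theorem homComp_mem_initialIdeal {p : WeylAlgebra K n} (hp : p ∈ I) {m : ℝ}
    (h : ∀ m', m < m' → homComp K w m' p = 0) : homComp K w m p ∈ initialIdeal w I := by
  by_cases hm : homComp K w m p = 0
  · rw [hm]; exact zero_mem _
  · rw [← initialForm_eq_homComp w h hm]
    exact Submodule.subset_span ⟨p, hp, rfl⟩

/-- To prove that every element of the initial ideal has a property it suffices to treat the
homogeneous components of top weight. -/
theorem initialIdeal_le {S : Submodule K (WeylAlgebra K n)}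
    (h : ∀ p ∈ I, ∀ m, (∀ m', m < m' → homComp K w m' p = 0) → homComp K w m p ∈ S) :
    initialIdeal w I ≤ S := by
  refine Submodule.span_le.mpr ?_
  rintro _ ⟨p, hp, rfl⟩
  obtain ⟨m, h1, h2⟩ := exists_initialForm_eq_homComp w p
  rw [h2]
  exact h p hp m h1

/-- `x_i` is homogeneous of weight `-w i`, so it shifts all components equally and carries the top
component of `q` to that of `x_i q`. -/
theorem x_mul_mem_initialIdeal (i : Fin n) {p : WeylAlgebra K n} (hp : p ∈ initialIdeal w I) :
    x K i * p ∈ initialIdeal w I := by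
  suffices initialIdeal w I ≤ (initialIdeal w I).comap (LinearMap.mulLeft K (x K i)) from this hp
  refine initialIdeal_le fun q hq m hm => ?_
  have h : x K i * homComp K w m q = homComp K w (m - w i) (x K i * q) := by
    rw [homComp_x_mul, sub_add_cancel]
  rw [Submodule.mem_comap, LinearMap.mulLeft_apply, h]
  refine homComp_mem_initialIdeal (I.mul_mem_left _ hq) fun m' hm' => ?_
  rw [homComp_x_mul, hm _ (by linarith), mul_zero]

theorem d_mul_mem_initialIdeal (i : Fin n) {p : WeylAlgebra K n} (hp : p ∈ initialIdeal w I) :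
    d K i * p ∈ initialIdeal w I := by
  suffices initialIdeal w I ≤ (initialIdeal w I).comap (LinearMap.mulLeft K (d K i)) from this hp
  refine initialIdeal_le fun q hq m hm => ?_
  have h : d K i * homComp K w m q = homComp K w (m + w i) (d K i * q) := by
    rw [homComp_d_mul, add_sub_cancel_right]
  rw [Submodule.mem_comap, LinearMap.mulLeft_apply, h]
  refine homComp_mem_initialIdeal (I.mul_mem_left _ hq) fun m' hm' => ?_
  rw [homComp_d_mul, hm _ (by linarith), mul_zero]

theorem mul_mem_initialIdeal (a : WeylAlgebra K n) {p : WeylAlgebra K n}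
    (hp : p ∈ initialIdeal w I) : a * p ∈ initialIdeal w I :=
  mul_mem_of_generators (fun i _ => x_mul_mem_initialIdeal i) (fun i _ => d_mul_mem_initialIdeal i)
    a hp

/-- The commutator with `s` scales each monomial by the image in `K` of minus its weight. The weight
is real while the scalar lies in `K`; `L` mediates between them, since a real weight determines an
element of `L` and hence its image in `K`. -/
theorem exists_eulerOp_mul_homComp_sub (L : Subfield ℝ) [Algebra L K] (w : Fin n → L) (m : ℝ) :
    ∃ c : K, ∀ p : WeylAlgebra K n,
      eulerOp (fun i => algebraMap L K (w i)) * homComp K (fun i => (w i : ℝ)) m p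
        - homComp K (fun i => (w i : ℝ)) m p * eulerOp (fun i => algebraMap L K (w i))
      = c • homComp K (fun i => (w i : ℝ)) m p := by
  classical
  set s : WeylAlgebra K n := eulerOp fun i => algebraMap L K (w i) with hs
  let v : (Fin n →₀ ℕ) × (Fin n →₀ ℕ) → L := fun e => ∑ i, w i * ((e.1 i : L) - (e.2 i : L))
  have hv : ∀ e, wt (fun i => (w i : ℝ)) e = -(v e : ℝ) := by
    intro e
    simp only [v, wt, AddSubmonoidClass.coe_finsetSum, ← Finset.sum_neg_distrib]
    refine Finset.sum_congr rfl fun i _ => ?_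
    push_cast
    ring
  have hsv : ∀ e, s * mono K e - mono K e * s = algebraMap L K (v e) • mono K e := by
    intro e
    rw [hs, eulerOp_mul_mono_sub]
    congr 1
    simp [v]
  obtain ⟨c, hc⟩ : ∃ c : K, ∀ e, wt (fun i => (w i : ℝ)) e = m → algebraMap L K (v e) = c := by
    by_cases h : ∃ e, wt (fun i => (w i : ℝ)) e = m
    · obtain ⟨e₀, rfl⟩ := h
      refine ⟨algebraMap L K (v e₀), fun e he => congrArg _ (Subtype.ext ?_)⟩
      rw [hv, hv] at he
      exact neg_injective he
    -- No monomial has weight `m`, so the component vanishes and any scalar works.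
    · exact ⟨0, fun e he => absurd ⟨e, he⟩ h⟩
  refine ⟨c, fun p => ?_⟩
  have : (LinearMap.mulLeft K s - LinearMap.mulRight K s) ∘ₗ homComp K (fun i => (w i : ℝ)) m
      = c • homComp K (fun i => (w i : ℝ)) m := by
    refine linearMap_ext_mono fun e => ?_
    simp only [LinearMap.comp_apply, LinearMap.sub_apply, LinearMap.mulLeft_apply,
      LinearMap.mulRight_apply, LinearMap.smul_apply, homComp_mono]
    split_ifs with h
    · rw [hsv, hc e h]
    · simp
  exact LinearMap.congr_fun this p

theorem mul_eulerOp_mem_initialIdeal (L : Subfield ℝ) [Algebra L K] (w : Fin n → L)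
    {p : WeylAlgebra K n} (hp : p ∈ initialIdeal (fun i => (w i : ℝ)) I) :
    p * eulerOp (fun i => algebraMap L K (w i)) ∈ initialIdeal (fun i => (w i : ℝ)) I := by
  set J := initialIdeal (fun i => (w i : ℝ)) I
  set s : WeylAlgebra K n := eulerOp fun i => algebraMap L K (w i) with hs
  suffices J ≤ J.comap (LinearMap.mulRight K s) from this hp
  refine initialIdeal_le fun q hq m hm => ?_
  obtain ⟨c, hc⟩ := exists_eulerOp_mul_homComp_sub (K := K) L w m
  have hmem : homComp K (fun i => (w i : ℝ)) m q ∈ J := homComp_mem_initialIdeal hq hm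
  rw [Submodule.mem_comap, LinearMap.mulRight_apply]
  have h : homComp K (fun i => (w i : ℝ)) m q * s
      = s * homComp K (fun i => (w i : ℝ)) m q - c • homComp K (fun i => (w i : ℝ)) m q := by
    rw [← hc q]; abel
  rw [h]
  exact sub_mem (mul_mem_initialIdeal _ hmem) (J.smul_mem _ hmem)

/-! ## Dimensions of truncations -/

/-- Induction on the set `S` of allowed weights, removing the largest. The top component map splits
`dim W` into its image, which lies in the initial ideal, and its kernel, which only has weights in
the smaller set. The vanishing conditions in the bound keep the two contributions independent. -/
theorem finrank_le_initialIdeal_inf (U : Submodule K (WeylAlgebra K n)) [FiniteDimensional K U]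
    (hU : ∀ m, ∀ p ∈ U, homComp K w m p ∈ U) (S : Finset ℝ) :
    ∀ W : Submodule K (WeylAlgebra K n), W ≤ U → (∀ p ∈ W, p ∈ I) →
      (∀ p ∈ W, ∀ m, m ∉ S → homComp K w m p = 0) →
      Module.finrank K W ≤ Module.finrank K
        (initialIdeal w I ⊓ U ⊓ ⨅ m : {m // m ∉ S}, LinearMap.ker (homComp K w m) :
          Submodule K (WeylAlgebra K n)) := by
  classical
  induction S using Finset.induction_on_max with
  | empty =>
    intro W _ _ h
    have : W = ⊥ := by
      rw [Submodule.eq_bot_iff]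
      exact fun p hp => eq_zero_of_homComp_eq_zero w fun m => h p hp m (Finset.notMem_empty m)
    rw [this, finrank_bot]
    exact Nat.zero_le _
  | insert m S hmax ih =>
    intro W hWU hWI hWS
    have hmS : m ∉ S := fun h => lt_irrefl _ (hmax m h)
    have : FiniteDimensional K W := Submodule.finiteDimensional_of_le hWU
    set A := initialIdeal w I ⊓ U with hA
    set f := (homComp K w m).domRestrict W with hf
    have h1 := LinearMap.finrank_range_add_finrank_ker f
    have h2 : Module.finrank K (LinearMap.ker f)
        = Module.finrank K ((LinearMap.ker f).map W.subtype) :=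
      LinearEquiv.finrank_eq (Submodule.equivMapOfInjective _ W.subtype_injective _)
    have h3 := ih ((LinearMap.ker f).map W.subtype) (Submodule.map_subtype_le _ _ |>.trans hWU)
      (fun p hp => hWI p (Submodule.map_subtype_le _ _ hp)) (by
        rintro _ ⟨⟨p, hp⟩, hpf, rfl⟩ m' hm'
        by_cases h : m' = m
        · subst h
          exact hpf
        · exact hWS p hp m' (by simp [h, hm']))
    set T := A ⊓ ⨅ m : {m // m ∉ S}, LinearMap.ker (homComp K w m) with hT
    -- Elements of the range are concentrated in weight `m`, whereas those of `T` have no component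
    -- there.
    have hdisj : Disjoint (LinearMap.range f) T := by
      rw [Submodule.disjoint_def]
      rintro _ ⟨⟨p, hp⟩, rfl⟩ ⟨_, hq⟩
      simp only [SetLike.mem_coe, Submodule.mem_iInf, Subtype.forall, LinearMap.mem_ker] at hq
      have := hq m hmS
      simp only [hf, LinearMap.domRestrict_apply] at this ⊢
      rwa [homComp_homComp_self] at this
    have hle : LinearMap.range f ⊔ T ≤
        A ⊓ ⨅ m' : {m' // m' ∉ insert m S}, LinearMap.ker (homComp K w m') := by
      refine sup_le ?_ ?_
      · rintro _ ⟨⟨p, hp⟩, rfl⟩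
        -- Maximality of `m` makes this component the top one, hence a member of the initial ideal.
        refine ⟨⟨homComp_mem_initialIdeal (hWI p hp) fun m' hm' => hWS p hp m' ?_,
          hU m p (hWU hp)⟩, ?_⟩
        · rw [Finset.mem_insert, not_or]
          exact ⟨hm'.ne', fun h => (hmax m' h).not_gt hm'⟩
        · simp only [SetLike.mem_coe, Submodule.mem_iInf, Subtype.forall, LinearMap.mem_ker]
          intro m' hm'
          exact homComp_homComp_of_ne w (fun h => hm' (by simp [h])) p
      · refine inf_le_inf_left _ ?_
        simp only [le_iInf_iff, Subtype.forall]
        exact fun m' hm' => iInf_le_of_le ⟨m', fun h => hm' (Finset.mem_insert_of_mem h)⟩ le_rfl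
    have : FiniteDimensional K A := Submodule.finiteDimensional_of_le inf_le_right
    have : FiniteDimensional K T := Submodule.finiteDimensional_of_le (S₂ := A) inf_le_left
    have : FiniteDimensional K
        (A ⊓ ⨅ m' : {m' // m' ∉ insert m S}, LinearMap.ker (homComp K w m') :
          Submodule K (WeylAlgebra K n)) :=
      Submodule.finiteDimensional_of_le (S₂ := A) inf_le_left
    have h4 := Submodule.finrank_sup_add_finrank_inf_eq (LinearMap.range f) T
    rw [hdisj.eq_bot, finrank_bot, add_zero] at h4
    have h5 := Submodule.finrank_mono hle
    omega

theorem finrank_inf_bernstein_le (w : Fin n → ℝ) (I : Ideal (WeylAlgebra K n)) (k : ℕ) :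
    Module.finrank K (I.restrictScalars K ⊓ bernstein K n k : Submodule K (WeylAlgebra K n))
      ≤ Module.finrank K
          (initialIdeal w I ⊓ bernstein K n k : Submodule K (WeylAlgebra K n)) := by
  classical
  -- `bernstein K n k` is spanned by monomials, so it contains the components of its elements, and
  -- only finitely many weights occur in it.
  refine (finrank_le_initialIdeal_inf (w := w) (I := I) (bernstein K n k)
    (fun m p hp => homComp_mem_bernstein w m hp) ((box n k).image (wt w)) _ inf_le_right
    (fun p hp => hp.1) ?_).trans ?_
  · intro p hp m hm
    replace hp : p ∈ bernstein K n k := hp.2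
    induction hp using Submodule.span_induction with
    | mem p hp =>
      obtain ⟨e, he, rfl⟩ := hp
      rw [homComp_mono, if_neg]
      rintro rfl
      exact hm (Finset.mem_image_of_mem _ (degLE_subset_box n k he))
    | zero => simp
    | add p q _ _ hp hq => rw [map_add, hp, hq, add_zero]
    | smul c p _ hp => rw [map_smul, hp, smul_zero]
  · have : FiniteDimensional K
        (initialIdeal w I ⊓ bernstein K n k : Submodule K (WeylAlgebra K n)) :=
      Submodule.finiteDimensional_of_le inf_le_right
    exact Submodule.finrank_mono inf_le_left

/-- Passing to the initial ideal does not increase the Hilbert function. -/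
theorem finrank_map_mkQ_initialIdeal_le (w : Fin n → ℝ) (I : Ideal (WeylAlgebra K n)) (k : ℕ) :
    Module.finrank K ((bernstein K n k).map (initialIdeal w I).mkQ)
      ≤ Module.finrank K ((bernstein K n k).map (I.restrictScalars K).mkQ) := by
  have h1 := finrank_map_mkQ (initialIdeal w I) (bernstein K n k)
  have h2 := finrank_map_mkQ (I.restrictScalars K) (bernstein K n k)
  have h3 := finrank_inf_bernstein_le w I k
  omega

end WeylAlgebra

namespace WeylAlgebra

/-! ## Joseph's counting argument -/

section Joseph

variable {K : Type*} [Field K] {n : ℕ}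

/-- The inner derivation `a ↦ [a, x_i]`. -/
noncomputable def adX (K : Type*) [Field K] {n : ℕ} (i : Fin n) :
    WeylAlgebra K n →ₗ[K] WeylAlgebra K n :=
  LinearMap.mulRight K (x K i) - LinearMap.mulLeft K (x K i)

/-- The inner derivation `a ↦ [∂_i, a]`. -/
noncomputable def adD (K : Type*) [Field K] {n : ℕ} (i : Fin n) :
    WeylAlgebra K n →ₗ[K] WeylAlgebra K n :=
  LinearMap.mulLeft K (d K i) - LinearMap.mulRight K (d K i)

theorem adX_apply (i : Fin n) (a : WeylAlgebra K n) : adX K i a = a * x K i - x K i * a := rfl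

theorem adD_apply (i : Fin n) (a : WeylAlgebra K n) : adD K i a = d K i * a - a * d K i := rfl

theorem adX_mono (i : Fin n) (e : (Fin n →₀ ℕ) × (Fin n →₀ ℕ)) :
    adX K i (mono K e) = (e.2 i : K) • mono K (e.1, e.2 - Finsupp.single i 1) :=
  mono_mul_x_sub i e

theorem adD_mono (i : Fin n) (e : (Fin n →₀ ℕ) × (Fin n →₀ ℕ)) :
    adD K i (mono K e) = (e.1 i : K) • mono K (e.1 - Finsupp.single i 1, e.2) :=
  d_mul_mono_sub i e

theorem adX_mem_bernstein (i : Fin n) {k : ℕ} {a : WeylAlgebra K n}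
    (ha : a ∈ bernstein K n (k + 1)) : adX K i a ∈ bernstein K n k := by
  induction ha using Submodule.span_induction with
  | mem p hp =>
    obtain ⟨e, he, rfl⟩ := hp
    simp only [degLE, Set.mem_ofPred_eq] at he
    rw [adX_mono]
    by_cases h : e.2 i = 0
    · simp [h]
    · refine Submodule.smul_mem _ _ (mono_mem_bernstein ?_)
      have := degree_tsub_single h
      simp only
      omega
  | zero => simp
  | add p q _ _ hp hq => rw [map_add]; exact add_mem hp hq
  | smul c p _ hp => rw [map_smul]; exact Submodule.smul_mem _ c hp

theorem adD_mem_bernstein (i : Fin n) {k : ℕ} {a : WeylAlgebra K n}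
    (ha : a ∈ bernstein K n (k + 1)) : adD K i a ∈ bernstein K n k := by
  induction ha using Submodule.span_induction with
  | mem p hp =>
    obtain ⟨e, he, rfl⟩ := hp
    simp only [degLE, Set.mem_ofPred_eq] at he
    rw [adD_mono]
    by_cases h : e.1 i = 0
    · simp [h]
    · refine Submodule.smul_mem _ _ (mono_mem_bernstein ?_)
      have := degree_tsub_single h
      simp only
      omega
  | zero => simp
  | add p q _ _ hp hq => rw [map_add]; exact add_mem hp hq
  | smul c p _ hp => rw [map_smul]; exact Submodule.smul_mem _ c hp

theorem exists_eq_algebraMap_of_mem_bernstein_zero {a : WeylAlgebra K n}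
    (ha : a ∈ bernstein K n 0) : ∃ c : K, a = algebraMap K _ c := by
  induction ha using Submodule.span_induction with
  | mem p hp =>
    obtain ⟨e, he, rfl⟩ := hp
    simp only [degLE, Set.mem_ofPred_eq, nonpos_iff_eq_zero, Nat.add_eq_zero_iff,
      Finsupp.degree_eq_zero_iff] at he
    exact ⟨1, by rw [map_one, one_eq_mono, show e = (0, 0) from Prod.ext he.1 he.2]⟩
  | zero => exact ⟨0, by simp⟩
  | add p q _ _ hp hq =>
    obtain ⟨c, rfl⟩ := hp
    obtain ⟨c', rfl⟩ := hq
    exact ⟨c + c', by simp⟩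
  | smul c p _ hp =>
    obtain ⟨c', rfl⟩ := hp
    exact ⟨c * c', by rw [map_mul, Algebra.smul_def]⟩

variable [CharZero K]

theorem repr_mono (e e' : (Fin n →₀ ℕ) × (Fin n →₀ ℕ)) :
    (basis K n).repr (mono K e) e' = Finsupp.single e (1 : K) e' := by
  rw [← basis_apply, Module.Basis.repr_self]

/-- Read backwards, this recovers each coefficient of `a` with positive exponent of `∂_i` from `[a,
x_i]`, the factor being invertible in characteristic zero. -/
theorem repr_adX (i : Fin n) (a : WeylAlgebra K n) (e : (Fin n →₀ ℕ) × (Fin n →₀ ℕ)) :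
    (basis K n).repr (adX K i a) e
      = ((e.2 i : K) + 1) * (basis K n).repr a (e.1, Finsupp.single i 1 + e.2) := by
  have : (basis K n).coord e ∘ₗ adX K i
      = ((e.2 i : K) + 1) • (basis K n).coord (e.1, Finsupp.single i 1 + e.2) := by
    refine linearMap_ext_mono fun e' => ?_
    simp only [LinearMap.comp_apply, LinearMap.smul_apply, adX_mono, map_smul,
      Module.Basis.coord_apply, repr_mono, smul_eq_mul]
    by_cases h : e' = (e.1, Finsupp.single i 1 + e.2)
    · subst h
      simp [add_comm]
    · rw [Finsupp.single_eq_of_ne (Ne.symm h), mul_zero]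
      by_cases h0 : e'.2 i = 0
      · simp [h0]
      · rw [Finsupp.single_eq_of_ne, mul_zero]
        rintro rfl
        exact h (Prod.ext rfl (single_add_tsub_single h0).symm)
  exact LinearMap.congr_fun this a

theorem repr_adD (i : Fin n) (a : WeylAlgebra K n) (e : (Fin n →₀ ℕ) × (Fin n →₀ ℕ)) :
    (basis K n).repr (adD K i a) e
      = ((e.1 i : K) + 1) * (basis K n).repr a (Finsupp.single i 1 + e.1, e.2) := by
  have : (basis K n).coord e ∘ₗ adD K i
      = ((e.1 i : K) + 1) • (basis K n).coord (Finsupp.single i 1 + e.1, e.2) := by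
    refine linearMap_ext_mono fun e' => ?_
    simp only [LinearMap.comp_apply, LinearMap.smul_apply, adD_mono, map_smul,
      Module.Basis.coord_apply, repr_mono, smul_eq_mul]
    by_cases h : e' = (Finsupp.single i 1 + e.1, e.2)
    · subst h
      simp [add_comm]
    · rw [Finsupp.single_eq_of_ne (Ne.symm h), mul_zero]
      by_cases h0 : e'.1 i = 0
      · simp [h0]
      · rw [Finsupp.single_eq_of_ne, mul_zero]
        rintro rfl
        exact h (Prod.ext (single_add_tsub_single h0).symm rfl)
  exact LinearMap.congr_fun this a

/-- Only constants commute with all generators. -/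
theorem mem_bernstein_zero_of_ad_eq_zero {a : WeylAlgebra K n} (hx : ∀ i, adX K i a = 0)
    (hd : ∀ i, adD K i a = 0) : a ∈ bernstein K n 0 := by
  have hcoef : ∀ e, e ≠ (0, 0) → (basis K n).repr a e = 0 := by
    rintro ⟨α, β⟩ he
    by_cases hα : α = 0
    · have hβ : β ≠ 0 := fun h => he (by rw [hα, h])
      obtain ⟨i, hi⟩ := Finsupp.ne_iff.mp hβ
      have := repr_adX i a (α, β - Finsupp.single i 1)
      rw [hx, map_zero, Finsupp.zero_apply, single_add_tsub_single hi] at this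
      exact (mul_eq_zero.mp this.symm).resolve_left (Nat.cast_add_one_ne_zero _)
    · obtain ⟨i, hi⟩ := Finsupp.ne_iff.mp hα
      have := repr_adD i a (α - Finsupp.single i 1, β)
      rw [hd, map_zero, Finsupp.zero_apply, single_add_tsub_single hi] at this
      exact (mul_eq_zero.mp this.symm).resolve_left (Nat.cast_add_one_ne_zero _)
  have h : (basis K n).repr a = Finsupp.single (0, 0) ((basis K n).repr a (0, 0)) := by
    refine Finsupp.ext fun e => ?_
    by_cases he : e = (0, 0)
    · rw [he, Finsupp.single_eq_same]
    · rw [hcoef e he, Finsupp.single_eq_of_ne he]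
  rw [← (basis K n).repr.symm_apply_apply a, h, Module.Basis.repr_symm_single, basis_apply]
  exact Submodule.smul_mem _ _ (mono_mem_bernstein (by simp))

variable {J : Submodule K (WeylAlgebra K n)} {s : WeylAlgebra K n}

/-- If `p ↦ ∑ u_j p s^j` maps the `k`-th step of the Bernstein filtration into the left ideal `J`,
where the `u_j` have degree at most `k` and are not all zero, then `J` meets `K[s]`. -/
theorem exists_aeval_mem_of_sum_mul_mem (hJ : ∀ a, ∀ p ∈ J, a * p ∈ J) {m : ℕ} (k : ℕ) :
    ∀ u : Fin m → WeylAlgebra K n, u ≠ 0 → (∀ j, u j ∈ bernstein K n k) →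
      (∀ p ∈ bernstein K n k, ∑ j, u j * p * s ^ (j : ℕ) ∈ J) →
      ∃ q : Polynomial K, q ≠ 0 ∧ Polynomial.aeval s q ∈ J := by
  -- Constants can be pulled out, and `p = 1` already yields a polynomial in `s`.
  have base : ∀ u : Fin m → WeylAlgebra K n, u ≠ 0 → (∀ j, u j ∈ bernstein K n 0) →
      (∑ j, u j * 1 * s ^ (j : ℕ) ∈ J) →
      ∃ q : Polynomial K, q ≠ 0 ∧ Polynomial.aeval s q ∈ J := by
    intro u hu h0 hJu
    choose c hc using fun j => exists_eq_algebraMap_of_mem_bernstein_zero (h0 j)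
    obtain ⟨j₀, hj₀⟩ := Function.ne_iff.mp hu
    refine ⟨∑ j : Fin m, Polynomial.monomial (j : ℕ) (c j), fun hq => hj₀ ?_, ?_⟩
    · have := congrArg (fun q => Polynomial.coeff q (j₀ : ℕ)) hq
      simp only [Polynomial.finsetSum_coeff, Polynomial.coeff_monomial, Polynomial.coeff_zero,
        Fin.val_inj, Finset.sum_ite_eq', Finset.mem_univ, if_true] at this
      rw [hc, this, map_zero, Pi.zero_apply]
    · simpa only [map_sum, Polynomial.aeval_monomial, hc, mul_one] using hJu
  induction k with
  | zero => exact fun u hu h0 h => base u hu h0 (h 1 (one_mem_bernstein 0))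
  | succ k ih =>
    intro u hu hk h
    -- Subtracting `x_i ∑ u_j p s^j` from the sum for `x_i p` leaves `∑ [u_j, x_i] p s^j`. The
    -- commutators have degree one less, at the cost of testing only `p` of degree at most `k`. The
    -- case of `∂_i` is symmetric.
    by_cases hx : ∃ i, (fun j => adX K i (u j)) ≠ 0
    · obtain ⟨i, hi⟩ := hx
      refine ih _ hi (fun j => adX_mem_bernstein i (hk j)) fun p hp => ?_
      have h1 := h _ (x_mul_mem_bernstein i hp)
      have h2 := hJ (x K i) _ (h p (bernstein_mono (Nat.le_succ k) hp))
      have h3 := J.sub_mem h1 h2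
      rw [Finset.mul_sum, ← Finset.sum_sub_distrib] at h3
      convert h3 using 2 with j
      rw [adX_apply, sub_mul, sub_mul]
      simp only [mul_assoc]
    by_cases hd : ∃ i, (fun j => adD K i (u j)) ≠ 0
    · obtain ⟨i, hi⟩ := hd
      refine ih _ hi (fun j => adD_mem_bernstein i (hk j)) fun p hp => ?_
      have h1 := h _ (d_mul_mem_bernstein i hp)
      have h2 := hJ (d K i) _ (h p (bernstein_mono (Nat.le_succ k) hp))
      have h3 := J.sub_mem h2 h1
      rw [Finset.mul_sum, ← Finset.sum_sub_distrib] at h3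
      convert h3 using 2 with j
      rw [adD_apply, sub_mul, sub_mul]
      simp only [mul_assoc]
    -- All commutators vanish, so every `u j` is a constant.
    push Not at hx hd
    exact base u hu (fun j => mem_bernstein_zero_of_ad_eq_zero (fun i => congrFun (hx i) j)
      fun i => congrFun (hd i) j) (h 1 (one_mem_bernstein _))

/-- Joseph's estimate: if the left ideal `J`, stable under right multiplication by `s`, does not
meet `K[s]`, then the Hilbert function of `J` is large. -/
theorem mul_finrank_bernstein_le (hJ : ∀ a, ∀ p ∈ J, a * p ∈ J) (hJs : ∀ p ∈ J, p * s ∈ J)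
    (hs : s ∈ bernstein K n 2) (hq : ∀ q : Polynomial K, Polynomial.aeval s q ∈ J → q = 0)
    (k N : ℕ) :
    (k + 1) * Module.finrank K (bernstein K n N)
      ≤ Module.finrank K ((bernstein K n N).map J.mkQ)
        * Module.finrank K ((bernstein K n (N + N + 2 * k)).map J.mkQ) := by
  set G := (bernstein K n N).map J.mkQ
  set H := (bernstein K n (N + N + 2 * k)).map J.mkQ with hH
  let b := Module.finBasis K G
  have hb : ∀ i, ∃ p ∈ bernstein K n N, J.mkQ p = b i := fun i => (b i).2
  choose P hPB hPb using hb
  have hspan : ∀ p ∈ bernstein K n N, ∃ c : Fin (Module.finrank K G) → K,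
      p - ∑ i, c i • P i ∈ J := by
    intro p hp
    have hpG : J.mkQ p ∈ G := Submodule.mem_map_of_mem hp
    refine ⟨b.repr ⟨J.mkQ p, hpG⟩, ?_⟩
    have h1 : J.mkQ p = _ := (congrArg Subtype.val (b.sum_repr ⟨J.mkQ p, hpG⟩)).symm
    rw [← Submodule.Quotient.mk_eq_zero, ← Submodule.mkQ_apply, map_sub, map_sum, sub_eq_zero]
    rw [AddSubmonoidClass.coe_finsetSum] at h1
    refine h1.trans ?_
    refine Finset.sum_congr rfl fun i _ => ?_
    rw [map_smul, hPb]
    rfl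
  have hJpow : ∀ j : ℕ, ∀ p ∈ J, p * s ^ j ∈ J := by
    intro j
    induction j with
    | zero => intro p hp; simpa using hp
    | succ j ih => intro p hp; rw [pow_succ, ← mul_assoc]; exact hJs _ (ih p hp)
  let T (p : WeylAlgebra K n) : (Fin (k + 1) → bernstein K n N) →ₗ[K] WeylAlgebra K n :=
    ∑ j : Fin (k + 1), LinearMap.mulRight K (p * s ^ (j : ℕ)) ∘ₗ
      (bernstein K n N).subtype ∘ₗ LinearMap.proj j
  have hT : ∀ p u, T p u = ∑ j, (u j : WeylAlgebra K n) * p * s ^ (j : ℕ) := by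
    intro p u
    simp [T, LinearMap.sum_apply, mul_assoc]
  have hTH : ∀ p ∈ bernstein K n N, ∀ u, J.mkQ (T p u) ∈ H := by
    intro p hp u
    refine Submodule.mem_map_of_mem ?_
    rw [hT]
    refine Submodule.sum_mem _ fun j _ => ?_
    refine bernstein_mono ?_ (mul_mem_bernstein (mul_mem_bernstein (u j).2 hp)
      (bernstein_pow_le 2 j (Submodule.pow_mem_pow _ hs j)))
    -- The degree is at most `N + N + 2j`, and `j ≤ k`.
    omega
  let Θ : (Fin (k + 1) → bernstein K n N) →ₗ[K] (Fin (Module.finrank K G) → H) :=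
    LinearMap.pi fun i => (J.mkQ ∘ₗ T (P i)).codRestrict H fun u => hTH _ (hPB i) u
  have hΘ : Function.Injective Θ := by
    rw [← LinearMap.ker_eq_bot, LinearMap.ker_eq_bot']
    intro u hu
    have h1 : ∀ i, T (P i) u ∈ J := by
      intro i
      have := congrArg Subtype.val (congrFun hu i)
      rw [← Submodule.Quotient.mk_eq_zero]
      exact this
    by_contra hne
    have hne' : (fun j => (u j : WeylAlgebra K n)) ≠ 0 := fun h =>
      hne (funext fun j => Subtype.ext (congrFun h j))
    obtain ⟨q, hq0, hqJ⟩ := exists_aeval_mem_of_sum_mul_mem (s := s) hJ N _ hne'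
      (fun j => (u j).2) fun p hp => by
        -- Modulo `J`, `p` is a combination of the `P i`. The error term stays in `J` after left
        -- multiplication by `u j` and right multiplication by powers of `s`.
        obtain ⟨c, hc⟩ := hspan p hp
        have h2 : ∑ j, (u j : WeylAlgebra K n) * (p - ∑ i, c i • P i) * s ^ (j : ℕ) ∈ J :=
          Submodule.sum_mem _ fun j _ => hJpow _ _ (hJ _ _ hc)
        have h3 : ∑ i, c i • T (P i) u ∈ J :=
          Submodule.sum_mem _ fun i _ => Submodule.smul_mem _ _ (h1 i)
        have h4 := J.add_mem h2 h3
        convert h4 using 1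
        simp only [hT, mul_sub, sub_mul, Finset.sum_sub_distrib, Finset.mul_sum, Finset.sum_mul,
          Finset.smul_sum, mul_smul_comm, smul_mul_assoc]
        rw [Finset.sum_comm (s := (Finset.univ : Finset (Fin (k + 1))))]
        abel
    exact hq0 (hq q hqJ)
  have hfin : FiniteDimensional K H := by rw [hH]; infer_instance
  have := LinearMap.finrank_le_finrank_of_injective hΘ
  simpa only [Module.finrank_pi_fintype, Finset.sum_const, Finset.card_univ, Fintype.card_fin,
    smul_eq_mul] using this

end Joseph

end WeylAlgebra

/-! ## Growth -/

/-- The definition of growth allows no multiplicative constant, so `(C + 1) ^ d` is absorbed into an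
extra factor `k ^ ε`. -/
theorem growthDegree_le_of_forall_le {f : ℕ → ℕ} {C d : ℕ} (h : ∀ k, f k ≤ (C * k + 1) ^ d) :
    growthDegree f ≤ d := by
  refine ENNReal.le_of_forall_pos_le_add fun ε hε _ => ?_
  have hlim := ((tendsto_rpow_atTop (NNReal.coe_pos.mpr hε)).comp
    tendsto_natCast_atTop_atTop).eventually_ge_atTop (((C : ℝ) + 1) ^ d)
  have hbound : ∀ᶠ k : ℕ in Filter.atTop,
      (f k : ℝ) ≤ (k : ℝ) ^ (((d : NNReal) + ε : NNReal) : ℝ) := by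
    filter_upwards [hlim, Filter.eventually_ge_atTop 1] with k hk hk1
    have hk0 : (0 : ℝ) < k := by exact_mod_cast hk1
    have hk1' : (1 : ℝ) ≤ k := by exact_mod_cast hk1
    calc (f k : ℝ) ≤ ((C * k + 1) ^ d : ℕ) := by exact_mod_cast h k
      _ = ((C : ℝ) * k + 1) ^ d := by push_cast; rfl
      _ ≤ (((C : ℝ) + 1) * k) ^ d := by gcongr; nlinarith
      _ = ((C : ℝ) + 1) ^ d * (k : ℝ) ^ d := mul_pow _ _ _
      _ ≤ (k : ℝ) ^ (ε : ℝ) * (k : ℝ) ^ d :=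
        mul_le_mul_of_nonneg_right hk (by positivity)
      _ = (k : ℝ) ^ (((d : NNReal) + ε : NNReal) : ℝ) := by
        rw [NNReal.coe_add, NNReal.coe_natCast, Real.rpow_add hk0, Real.rpow_natCast, mul_comm]
  have hle : growthDegree f ≤ (((d : NNReal) + ε : NNReal) : ENNReal) :=
    iInf_le_of_le ((d : NNReal) + ε) (iInf_le _ hbound)
  simpa using hle

theorem exists_eventually_le_of_growthDegree_lt {f : ℕ → ℕ} {a : ENNReal}
    (h : growthDegree f < a) :
    ∃ r : NNReal, (r : ENNReal) < a ∧
      ∀ᶠ k : ℕ in Filter.atTop, (f k : ℝ) ≤ (k : ℝ) ^ (r : ℝ) := by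
  unfold growthDegree at h
  simp only [iInf_lt_iff] at h
  obtain ⟨r, hr, hra⟩ := h
  exact ⟨r, hra, hr⟩

/-- A product of two values of a function of growth less than `d + 1/2`, taken at linear arguments,
cannot dominate `k ^ (2 d + 1)`. -/
theorem not_forall_pow_le_mul_of_growthDegree_le {f : ℕ → ℕ} {d : ℕ} (hf : growthDegree f ≤ d)
    {a b : ℕ} (ha : 0 < a) (hb : 0 < b) :
    ¬ ∀ k, (k + 1) ^ (2 * d + 1) ≤ f (a * k) * f (b * k) := by
  intro hall
  -- Any slack up to `1 / 2` would do: what matters is an exponent `r` with `2 r < 2 d + 1`.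
  have hlt : growthDegree f < ((d + 1 / 4 : NNReal) : ENNReal) := by
    refine hf.trans_lt ?_
    rw [← ENNReal.coe_natCast, ENNReal.coe_lt_coe]
    exact lt_add_of_pos_right _ (by norm_num)
  obtain ⟨r, hr, hfr⟩ := exists_eventually_le_of_growthDegree_lt hlt
  have hr' : (r : ℝ) < d + 1 / 4 := by
    have := NNReal.coe_lt_coe.mpr (ENNReal.coe_lt_coe.mp hr)
    push_cast at this
    exact this
  have hscale : ∀ c : ℕ, 0 < c → Filter.Tendsto (fun k => c * k) Filter.atTop Filter.atTop :=
    fun c hc => Filter.tendsto_id.const_mul_atTop' hc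
  have hlim := ((tendsto_rpow_atTop (y := 2 * d + 1 - 2 * r) (by linarith)).comp
    tendsto_natCast_atTop_atTop).eventually_gt_atTop ((a : ℝ) ^ (r : ℝ) * (b : ℝ) ^ (r : ℝ))
  obtain ⟨k, hka, hkb, hk, hk1⟩ := ((hscale a ha).eventually hfr |>.and
    ((hscale b hb).eventually hfr |>.and (hlim.and (Filter.eventually_ge_atTop 1)))).exists
  have hk0 : (0 : ℝ) < k := by exact_mod_cast hk1
  have h1 : ((k : ℝ) + 1) ^ (2 * d + 1) ≤ f (a * k) * f (b * k) := by exact_mod_cast hall k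
  have h2 : (k : ℝ) ^ ((2 * d + 1 : ℕ) : ℝ)
      ≤ ((a : ℝ) ^ (r : ℝ) * (b : ℝ) ^ (r : ℝ)) * (k : ℝ) ^ (2 * (r : ℝ)) := by
    calc (k : ℝ) ^ ((2 * d + 1 : ℕ) : ℝ) = (k : ℝ) ^ (2 * d + 1) := Real.rpow_natCast _ _
      _ ≤ ((k : ℝ) + 1) ^ (2 * d + 1) := by gcongr; linarith
      _ ≤ f (a * k) * f (b * k) := h1
      _ ≤ ((a * k : ℕ) : ℝ) ^ (r : ℝ) * ((b * k : ℕ) : ℝ) ^ (r : ℝ) := by gcongr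
      _ = _ := by
        rw [two_mul, Real.rpow_add hk0]
        push_cast
        rw [Real.mul_rpow (by positivity) hk0.le, Real.mul_rpow (by positivity) hk0.le]
        ring
  have h3 : (k : ℝ) ^ ((2 * d + 1 : ℕ) : ℝ)
      = (k : ℝ) ^ ((2 : ℝ) * d + 1 - 2 * r) * (k : ℝ) ^ (2 * (r : ℝ)) := by
    rw [← Real.rpow_add hk0]
    congr 1
    push_cast
    ring
  rw [h3] at h2
  exact absurd (le_of_mul_le_mul_right h2 (Real.rpow_pos_of_pos hk0 _)) (not_le.mpr hk)

namespace WeylAlgebra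

/-! ### Gelfand-Kirillov dimension of quotients of the Weyl algebra -/

variable {K : Type*} [Field K] {n : ℕ}

theorem exists_le_map_bernstein {A : Type*} [Ring A] [Algebra K A] (f : WeylAlgebra K n →ₐ[K] A)
    (hf : Function.Surjective f) (V : Submodule K A) (hV : V.FG) :
    ∃ l, V ≤ (bernstein K n l).map f.toLinearMap := by
  induction V, hV using Submodule.fg_induction with
  | singleton x =>
    obtain ⟨p, rfl⟩ := hf x
    obtain ⟨l, hl⟩ := exists_mem_bernstein p
    refine ⟨l, ?_⟩
    rw [Submodule.span_singleton_le_iff_mem]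
    exact Submodule.mem_map_of_mem (f := f.toLinearMap) hl
  | sup V W _ _ hV hW =>
    obtain ⟨k, hk⟩ := hV
    obtain ⟨l, hl⟩ := hW
    exact ⟨max k l, sup_le (hk.trans (Submodule.map_mono (bernstein_mono (le_max_left _ _))))
      (hl.trans (Submodule.map_mono (bernstein_mono (le_max_right _ _))))⟩

/-- Every quotient algebra of the `n`-th Weyl algebra has Gelfand-Kirillov dimension at most
`2 n`. -/
theorem algGKDim_le_of_surjective {A : Type*} [Ring A] [Algebra K A]
    (f : WeylAlgebra K n →ₐ[K] A) (hf : Function.Surjective f) :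
    algGKDim K A ≤ (2 * n : ℕ) := by
  refine iSup_le fun V => iSup_le fun hV => iSup_le fun _ => ?_
  obtain ⟨l, hl⟩ := exists_le_map_bernstein f hf V (Module.Finite.iff_fg.mp hV)
  refine growthDegree_le_of_forall_le (C := l) fun k => ?_
  have h1 : V ^ k ≤ (bernstein K n (l * k)).map f.toLinearMap := by
    refine (pow_le_pow_left' hl k).trans ?_
    rw [← Submodule.map_pow]
    exact Submodule.map_mono (bernstein_pow_le l k)
  exact (Submodule.finrank_mono h1).trans
    ((Submodule.finrank_map_le _ _).trans (finrank_bernstein_le _))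

/-- The algebra `D / Ann M` is a quotient of `D`, so twice the dimension of `M` is at most `2n`. -/
theorem moduleGKDim_le_of_isHolonomic {M : Type*} [AddCommGroup M] [Module K M]
    [Module (WeylAlgebra K n) M] [IsScalarTower K (WeylAlgebra K n) M]
    (h : IsHolonomic K (WeylAlgebra K n) M) : moduleGKDim K (WeylAlgebra K n) M ≤ n := by
  have h1 := algGKDim_le_of_surjective
    (Ideal.Quotient.mkₐ K (Module.annihilator (WeylAlgebra K n) M))
    (Ideal.Quotient.mkₐ_surjective _ _)
  rw [IsHolonomic] at h
  rw [h, Nat.cast_mul, Nat.cast_ofNat] at h1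
  exact (ENNReal.mul_le_mul_iff_right (by simp) (by simp)).mp h1

/-- Take `V = B_1` and `F` the line through the class of `1` in the supremum; then `V^k F` is the
image of `B_k`. -/
theorem growthDegree_bernstein_le_moduleGKDim (I : Ideal (WeylAlgebra K n)) :
    growthDegree (fun k => Module.finrank K ((bernstein K n k).map (I.restrictScalars K).mkQ))
      ≤ moduleGKDim K (WeylAlgebra K n) (WeylAlgebra K n ⧸ I) := by
  have key : ∀ k, Module.finrank K ((bernstein K n k).map (I.restrictScalars K).mkQ)
      = Module.finrank K (Submodule.span K (Set.image2
        (fun (a : WeylAlgebra K n) (m : WeylAlgebra K n ⧸ I) => a • m)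
        ((bernstein K n 1 ^ k : Submodule K (WeylAlgebra K n)) : Set (WeylAlgebra K n))
        (Submodule.span K {(Submodule.Quotient.mk 1 : WeylAlgebra K n ⧸ I)} :
          Set (WeylAlgebra K n ⧸ I)))) := by
    intro k
    have hB : bernstein K n 1 ^ k = bernstein K n k :=
      le_antisymm ((bernstein_pow_le 1 k).trans (by rw [one_mul])) (bernstein_le_pow k)
    let g : WeylAlgebra K n →ₗ[K] WeylAlgebra K n ⧸ I := I.mkQ.restrictScalars K
    have hspan : Submodule.span K (Set.image2
        (fun (a : WeylAlgebra K n) (m : WeylAlgebra K n ⧸ I) => a • m)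
        ((bernstein K n 1 ^ k : Submodule K (WeylAlgebra K n)) : Set (WeylAlgebra K n))
        (Submodule.span K {(Submodule.Quotient.mk 1 : WeylAlgebra K n ⧸ I)} :
          Set (WeylAlgebra K n ⧸ I))) = (bernstein K n k).map g := by
      rw [hB]
      refine le_antisymm (Submodule.span_le.mpr ?_) ?_
      · rintro _ ⟨a, ha, m, hm, rfl⟩
        obtain ⟨c, rfl⟩ := Submodule.mem_span_singleton.mp hm
        refine ⟨c • a, Submodule.smul_mem _ c ha, ?_⟩
        change Submodule.Quotient.mk (c • a) = a • c • Submodule.Quotient.mk 1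
        rw [← Submodule.Quotient.mk_smul, ← Submodule.Quotient.mk_smul, smul_eq_mul,
          mul_smul_comm, mul_one]
      · rintro _ ⟨a, ha, rfl⟩
        refine Submodule.subset_span ⟨a, ha, _, Submodule.mem_span_singleton_self _, ?_⟩
        change a • Submodule.Quotient.mk 1 = Submodule.Quotient.mk a
        rw [← Submodule.Quotient.mk_smul, smul_eq_mul, mul_one]
    rw [hspan]
    -- The quotients by `I` over `D` and over `K` are different types, so the two images are
    -- compared by rank-nullity: the kernels agree.
    have h1 := LinearMap.finrank_range_add_finrank_ker (g.domRestrict (bernstein K n k))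
    have h2 := LinearMap.finrank_range_add_finrank_ker
      ((I.restrictScalars K).mkQ.domRestrict (bernstein K n k))
    have h3 : LinearMap.ker g = I.restrictScalars K := by
      ext a
      simp [g]
    rw [LinearMap.range_domRestrict, LinearMap.ker_domRestrict, h3] at h1
    rw [LinearMap.range_domRestrict, LinearMap.ker_domRestrict, Submodule.ker_mkQ] at h2
    omega
  simp only [key]
  refine le_trans ?_ (le_iSup₂ (bernstein K n 1) (finiteDimensional_bernstein 1))
  refine le_trans ?_ (le_iSup₂ (one_mem_bernstein 1) (Submodule.span K {Submodule.Quotient.mk 1}))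
  exact le_iSup_of_le (FiniteDimensional.span_singleton K _) le_rfl

/-! ## The global b-function -/

section BFunction

/-- Powers of one variable are eigenvectors of the Euler operator; their eigenvalues will show that
`s` is transcendental. -/
theorem polyAction_eulerOp_X_pow (c : Fin n → K) (i : Fin n) (k : ℕ) :
    polyAction K n (eulerOp c) (MvPolynomial.X i ^ k)
      = (c i * k) • (MvPolynomial.X i ^ k : MvPolynomial (Fin n) K) := by
  rw [eulerOp, map_sum, LinearMap.sum_apply, Finset.sum_eq_single i]
  · rw [map_smul, map_mul, LinearMap.smul_apply, Module.End.mul_apply, polyAction_d, polyAction_x,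
      Derivation.leibniz_pow, MvPolynomial.pderiv_X_self, mul_smul]
    cases k with
    | zero => simp
    | succ k =>
      simp only [smul_eq_mul, mul_one, nsmul_eq_mul, MvPolynomial.smul_eq_C_mul, map_natCast,
        Nat.add_sub_cancel]
      ring
  · intro j _ hj
    rw [map_smul, map_mul, LinearMap.smul_apply, Module.End.mul_apply, polyAction_d, polyAction_x,
      Derivation.leibniz_pow, MvPolynomial.pderiv_X_of_ne hj.symm]
    simp
  · simp

variable [CharZero K]

/-- For a holonomic quotient the initial ideal contains a nonzero polynomial in the Euler
operator. -/
theorem exists_aeval_eulerOp_mem_initialIdeal (L : Subfield ℝ) [Algebra L K] (w : Fin n → L)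
    (I : Ideal (WeylAlgebra K n))
    (hI : IsHolonomic K (WeylAlgebra K n) (WeylAlgebra K n ⧸ I)) :
    ∃ q : Polynomial K, q ≠ 0 ∧ Polynomial.aeval (eulerOp fun i => algebraMap L K (w i)) q
      ∈ initialIdeal (fun i => (w i : ℝ)) I := by
  by_contra! hno
  -- Joseph's estimate is applied with `N = (2n+1)k`. It exceeds the `2nk` needed for `dim B_N ≥
  -- (k+1)^(2n)`, and its coefficient is positive even for `n = 0`. Then `2N + 2k = (4n+4)k`.
  refine not_forall_pow_le_mul_of_growthDegree_le
    ((growthDegree_bernstein_le_moduleGKDim I).trans (moduleGKDim_le_of_isHolonomic hI))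
    (a := 2 * n + 1) (b := 4 * n + 4) (by omega) (by omega) fun k => ?_
  have h1 := mul_finrank_bernstein_le (J := initialIdeal (fun i => (w i : ℝ)) I)
    (fun a _ hp => mul_mem_initialIdeal a hp) (fun _ hp => mul_eulerOp_mem_initialIdeal L w hp)
    (eulerOp_mem_bernstein _) (fun q hq => by_contra fun h => hno q h hq) k ((2 * n + 1) * k)
  have h2 : (k + 1) ^ (2 * n) ≤ Module.finrank K (bernstein K n ((2 * n + 1) * k)) :=
    (le_finrank_bernstein k).trans (Submodule.finrank_mono (bernstein_mono (by nlinarith)))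
  have h3 : (2 * n + 1) * k + (2 * n + 1) * k + 2 * k = (4 * n + 4) * k := by ring
  rw [h3] at h1
  calc (k + 1) ^ (2 * n + 1) = (k + 1) * (k + 1) ^ (2 * n) := by ring
    _ ≤ _ := Nat.mul_le_mul_left _ h2
    _ ≤ _ := h1
    _ ≤ _ := Nat.mul_le_mul (finrank_map_mkQ_initialIdeal_le _ _ _)
      (finrank_map_mkQ_initialIdeal_le _ _ _)

/-- If `q(s) = 0`, then `q` vanishes at the eigenvalue `c i * k` of `s` on `X_i^k` for every `k`.
With `c i ≠ 0` in characteristic zero these are infinitely many roots. -/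
theorem aeval_eulerOp_injective {c : Fin n → K} (hc : c ≠ 0) :
    Function.Injective (Polynomial.aeval (R := K) (eulerOp c)) := by
  obtain ⟨i, hi⟩ := Function.ne_iff.mp hc
  rw [injective_iff_map_eq_zero]
  intro q hq
  have heval : ∀ k : ℕ, q.eval (c i * k) = 0 := by
    intro k
    have h1 := Module.End.aeval_apply_of_hasEigenvector (p := q)
      (f := polyAction K n (eulerOp c)) (μ := c i * k)
      (x := (MvPolynomial.X i ^ k : MvPolynomial (Fin n) K))
      ⟨Module.End.mem_eigenspace_iff.mpr (polyAction_eulerOp_X_pow c i k),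
        pow_ne_zero _ (MvPolynomial.X_ne_zero i)⟩
    rw [Polynomial.aeval_algHom_apply, hq, map_zero, LinearMap.zero_apply] at h1
    exact (smul_eq_zero.mp h1.symm).resolve_right (pow_ne_zero _ (MvPolynomial.X_ne_zero i))
  refine Polynomial.eq_zero_of_infinite_isRoot q ?_
  refine (Set.infinite_range_of_injective (f := fun k : ℕ => c i * (k : K)) ?_).mono ?_
  · intro k l hkl
    exact Nat.cast_injective (mul_left_cancel₀ hi hkl)
  · rintro _ ⟨k, rfl⟩
    exact heval k

end BFunction

end WeylAlgebra

/-- A subspace of `A` stable under left multiplication, containing a nonzero polynomial in a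
transcendental element `s`, has a unique global b-function, and it is nonzero. -/
theorem exists_unique_isGlobalBFunction {K A : Type*} [Field K] [Ring A] [Algebra K A]
    {J : Submodule K A} {s : A} (hJ : ∀ a, ∀ p ∈ J, a * p ∈ J)
    (hs : Function.Injective (Polynomial.aeval (R := K) s))
    (h : ∃ q : Polynomial K, q ≠ 0 ∧ Polynomial.aeval s q ∈ J) :
    ∃ b : Polynomial K, IsGlobalBFunction J s b ∧
      (∀ b' : Polynomial K, IsGlobalBFunction J s b' → b' = b) ∧ b ≠ 0 := by
  classical
  -- Transcendence of `s` turns the equality of sets in `A` into divisibility in the polynomial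
  -- ring.
  have hmem : ∀ b : Polynomial K, IsGlobalBFunction J s b → ∀ q : Polynomial K,
      Polynomial.aeval s q ∈ J ↔ b ∣ q := by
    rintro b ⟨_, hb⟩ q
    have h1 := Set.ext_iff.mp hb (Polynomial.aeval s q)
    have h2 : Polynomial.aeval s q ∈ Algebra.adjoin K {s} :=
      Polynomial.aeval_mem_adjoin_singleton K s
    simp only [SetLike.mem_coe, Submodule.mem_inf, Subalgebra.mem_toSubmodule, h2, and_true,
      Set.mem_range] at h1
    rw [h1]
    constructor
    · rintro ⟨r, hr⟩
      rw [← map_mul] at hr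
      exact ⟨r, by rw [← hs hr, mul_comm]⟩
    · rintro ⟨r, rfl⟩
      exact ⟨r, by rw [← map_mul, mul_comm]⟩
  -- The pullback of `J` along `aeval s` is an ideal because `J` is stable under left
  -- multiplication; its normalized generator is the b-function.
  let 𝔞 : Ideal (Polynomial K) :=
    { carrier := {q | Polynomial.aeval s q ∈ J}
      zero_mem' := by
        change Polynomial.aeval s 0 ∈ J
        rw [map_zero]
        exact J.zero_mem
      add_mem' := fun {p q} hp hq => by
        change Polynomial.aeval s (p + q) ∈ J
        rw [map_add]
        exact J.add_mem hp hq
      smul_mem' := fun c q hq => by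
        change Polynomial.aeval s (c * q) ∈ J
        rw [map_mul]
        exact hJ _ _ hq }
  have h𝔞 : ∀ q, q ∈ 𝔞 ↔ Polynomial.aeval s q ∈ J := fun q => Iff.rfl
  obtain ⟨g, hg⟩ := (IsPrincipalIdealRing.principal 𝔞).principal
  have hgdvd : ∀ q, Polynomial.aeval s q ∈ J ↔ normalize g ∣ q := fun q => by
    rw [normalize_dvd_iff, ← h𝔞, hg]
    exact Ideal.mem_span_singleton
  obtain ⟨q₀, hq₀, hq₀J⟩ := h
  have hb0 : normalize g ≠ 0 := fun h0 => hq₀ (zero_dvd_iff.mp (h0 ▸ (hgdvd q₀).mp hq₀J))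
  have hg0 : g ≠ 0 := fun h0 => hb0 (by rw [h0, normalize_zero])
  have hmonic : (normalize g).Monic := Polynomial.monic_normalize hg0
  refine ⟨normalize g, ⟨Or.inr hmonic, Set.ext fun p => ?_⟩, fun b' hb' => ?_, hb0⟩
  · simp only [SetLike.mem_coe, Submodule.mem_inf, Subalgebra.mem_toSubmodule, Set.mem_range]
    constructor
    · rintro ⟨hp, hps⟩
      rw [Algebra.adjoin_singleton_eq_range_aeval] at hps
      obtain ⟨q, rfl⟩ := hps
      obtain ⟨r, rfl⟩ := (hgdvd q).mp hp
      exact ⟨r, by rw [← map_mul, mul_comm]; rfl⟩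
    · rintro ⟨r, rfl⟩
      rw [← map_mul]
      exact ⟨(hgdvd _).mpr (Dvd.intro_left r rfl), Polynomial.aeval_mem_adjoin_singleton K s⟩
  -- Two candidates divide each other. Dividing a nonzero polynomial excludes `b' = 0`, so both are
  -- monic and hence equal.
  · have h1 : b' ∣ normalize g := (hmem b' hb' _).mp ((hgdvd _).mpr dvd_rfl)
    have h2 : normalize g ∣ b' := (hgdvd _).mp ((hmem b' hb' _).mpr dvd_rfl)
    have hb'0 : b' ≠ 0 := fun h0 => hb0 (zero_dvd_iff.mp (h0 ▸ h1))
    exact Polynomial.eq_of_monic_of_associated (hb'.1.resolve_left hb'0) hmonic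
      (associated_of_dvd_dvd h1 h2)

theorem theorem4p3 {K : Type*} [Field K] [CharZero K] {n : ℕ}
    (L : Subfield ℝ) [Algebra L K] (w : Fin n → L)
    (hw0 : w ≠ 0) (hw : ∀ i, 0 ≤ (w i : ℝ))
    (I : Ideal (WeylAlgebra K n))
    (hI : IsHolonomic K (WeylAlgebra K n) (WeylAlgebra K n ⧸ I)) :
    (WeylAlgebra.initialIdeal (fun i => (w i : ℝ)) I ⊓
        Subalgebra.toSubmodule
          (Algebra.adjoin K {WeylAlgebra.eulerOp fun i => algebraMap L K (w i)}) ≠ ⊥) ∧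
    ∃ b : Polynomial K,
      IsGlobalBFunction (WeylAlgebra.initialIdeal (fun i => (w i : ℝ)) I)
          (WeylAlgebra.eulerOp fun i => algebraMap L K (w i)) b ∧
        (∀ b' : Polynomial K,
          IsGlobalBFunction (WeylAlgebra.initialIdeal (fun i => (w i : ℝ)) I)
            (WeylAlgebra.eulerOp fun i => algebraMap L K (w i)) b' → b' = b) ∧
        b ≠ 0 := by
  have hJ : ∀ a, ∀ p ∈ WeylAlgebra.initialIdeal (fun i => (w i : ℝ)) I,
      a * p ∈ WeylAlgebra.initialIdeal (fun i => (w i : ℝ)) I :=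
    fun a _ hp => WeylAlgebra.mul_mem_initialIdeal a hp
  -- The field map from `L` to `K` is injective, so `w ≠ 0` survives in `K`.
  have hs := WeylAlgebra.aeval_eulerOp_injective (c := fun i => algebraMap L K (w i)) (fun h =>
    hw0 (funext fun i => (algebraMap L K).injective ((congrFun h i).trans (map_zero _).symm)))
  have hq := WeylAlgebra.exists_aeval_eulerOp_mem_initialIdeal L w I hI
  refine ⟨fun hbot => ?_, exists_unique_isGlobalBFunction hJ hs hq⟩
  obtain ⟨q, hq0, hqJ⟩ := hq
  refine hq0 (hs ?_)
  rw [map_zero, ← Submodule.mem_bot K, ← hbot]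
  exact ⟨hqJ, Polynomial.aeval_mem_adjoin_singleton K _⟩
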